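/- Let $\Gamma$ be an abelian group (written additively). All rings are associative with identity, graded means $\Gamma$-graded, and modules are right modules. A *graded field* is a nonzero commutative graded ring $A=\bigoplus_{\gamma\in\Gamma}A_\gamma$ in which every nonzero homogeneous element is invertible. A *graded $A$-algebra* is a graded ring $R$ that is an $A$-algebra whose structure map $A\to R$ is a graded homomorphism; $R\cong_{\mathrm{gr}}S$ as graded $A$-algebras means that there is an $A$-algebra isomorphism $R\to S$ mapping $R_\gamma$ onto $S_\gamma$ for every $\gamma\in\Gamma$. For $\bar\delta=(\delta_1,\dots,\delta_n)\in\Gamma^n$ let $\mathbb M_n(A)(\bar\delta)$ be the matrix algebra $\mathbb M_n(A)$ graded so that its component of degree $\gamma$ consists of the matrices whose $(j,k)$ entry lies in $A_{\gamma+\delta_k-\delta_j}$ for all $j,k$. A *graded matricial $A$-algebra* is a graded $A$-algebra isomorphic, as a graded $A$-algebra, to a finite product $\mathbb M_{n_1}(A)(\bar\delta_1)\times\cdots\times\mathbb M_{n_l}(A)(\bar\delta_l)$. A *graded ultramatricial $A$-algebra* is a graded $A$-algebra $R$ which is the union of a sequence $R_1\subseteq R_2\subseteq\cdots$ of graded $A$-subalgebras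 (with the same identity as $R$ and with the gradings induced from $R$), each of which is graded matricial. For a graded ring $R$ let $\mathcal V^{\mathrm{gr}}(R)$ be the commutative monoid of graded isomorphism classes $[P]$ of graded finitely generated projective right $R$-modules, with $[P]+[Q]=[P\oplus Q]$. The group $\Gamma$ acts on it by $\gamma\cdot[P]=[P(\gamma)]$, where $P(\gamma)_\lambda=P_{\gamma+\lambda}$. The *graded Grothendieck group* $K_0^{\mathrm{gr}}(R)$ is the group completion of $\mathcal V^{\mathrm{gr}}(R)$, with the induced structure of a $\mathbb Z[\Gamma]$-module; it is pre-ordered by the positive cone $K_0^{\mathrm{gr}}(R)_+$, the image of $\mathcal V^{\mathrm{gr}}(R)$, i.e. $x\le y$ if and only if $y-x\in K_0^{\mathrm{gr}}(R)_+$. **Theorem.** Let $A$ be a $\Gamma$-graded field and let $R$ and $S$ be $\Gamma$-graded ultramatricial $A$-algebras. Then $R\cong_{\mathrm{gr}}S$ as graded $A$-algebras if and only if there is an isomorphism of $\mathbb Z[\Gamma]$-modules $f:K_0^{\mathrm{gr}}(R)\to K_0^{\mathrm{gr}}(S)$ such that $f\big(K_0^{\mathrm{gr}}(R)_+\big)=K_0^{\mathrm{gr}}(S)_+$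 and $f([R])=[S]$. -/

import Mathlib

open DirectSum MulOpposite

universe uΓ uA uR uS

/-! ### Graded fields and graded algebras -/

/-- A `Γ`-graded field: a nonzero commutative `Γ`-graded ring in which every nonzero homogeneous
element is invertible. -/
structure IsGradedField {Γ : Type uΓ} [AddCommGroup Γ] [DecidableEq Γ] {A : Type uA} [CommRing A]
    (𝒜 : Γ → AddSubgroup A) [GradedRing 𝒜] : Prop where
  nontrivial : Nontrivial A
  isUnit_of_mem : ∀ (γ : Γ) (a : A), a ∈ 𝒜 γ → a ≠ 0 → IsUnit a

/-- The graded ring `R`, which is an `A`-algebra over the commutative graded ring `A`, is a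
graded `A`-algebra: the structure map `A → R` is a graded homomorphism. -/
def IsGradedAlgebra {Γ : Type uΓ} {A : Type uA} [CommRing A] (𝒜 : Γ → AddSubgroup A)
    {R : Type uR} [Ring R] [Algebra A R] (𝓡 : Γ → AddSubgroup R) : Prop :=
  ∀ (γ : Γ) (a : A), a ∈ 𝒜 γ → algebraMap A R a ∈ 𝓡 γ

/-- An isomorphism of `A`-algebras respecting the gradings, i.e. an isomorphism of
graded `A`-algebras. -/
def IsGradedAlgEquiv {Γ : Type uΓ} {A : Type uA} [CommRing A]
    {R : Type uR} [Ring R] [Algebra A R] (𝓡 : Γ → AddSubgroup R)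
    {S : Type uS} [Ring S] [Algebra A S] (𝓢 : Γ → AddSubgroup S) (e : R ≃ₐ[A] S) : Prop :=
  ∀ (γ : Γ) (x : R), x ∈ 𝓡 γ ↔ e x ∈ 𝓢 γ

/-! ### Graded matricial and ultramatricial algebras -/

/-- The homogeneous component of degree `γ` of `𝕄_n(A)(δ₁, …, δₙ)`: the matrices whose
`(j, k)` entry lies in `A_{γ + δ_k - δ_j}`. -/
def matrixGrading {Γ : Type uΓ} [AddCommGroup Γ] {A : Type uA} [CommRing A]
    (𝒜 : Γ → AddSubgroup A) {n : ℕ} (δ : Fin n → Γ) (γ : Γ) :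
    AddSubgroup (Matrix (Fin n) (Fin n) A) where
  carrier := {M | ∀ j k, M j k ∈ 𝒜 (γ + δ k - δ j)}
  zero_mem' := fun _ _ => zero_mem _
  add_mem' := fun hM hN j k => add_mem (hM j k) (hN j k)
  neg_mem' := fun hM j k => neg_mem (hM j k)

/-- The product grading on `𝕄_{n₁}(A)(δ₁) × ⋯ × 𝕄_{n_l}(A)(δ_l)`. -/
def matricialGrading {Γ : Type uΓ} [AddCommGroup Γ] {A : Type uA} [CommRing A]
    (𝒜 : Γ → AddSubgroup A) {l : ℕ} {n : Fin l → ℕ} (δ : ∀ i, Fin (n i) → Γ) (γ : Γ) :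
    AddSubgroup (∀ i, Matrix (Fin (n i)) (Fin (n i)) A) where
  carrier := {x | ∀ i, x i ∈ matrixGrading 𝒜 (δ i) γ}
  zero_mem' := fun _ => zero_mem _
  add_mem' := fun hx hy i => add_mem (hx i) (hy i)
  neg_mem' := fun hx i => neg_mem (hx i)

/-- `T` (with the family `𝓣` of homogeneous components) is a graded matricial `A`-algebra: it is
isomorphic, as a graded `A`-algebra, to a finite product of matrix algebras `𝕄_{n_i}(A)(δ_i)`.
(Empty products and blocks of size `0` are permitted; the latter contribute a zero factor.) -/
def IsGradedMatricial {Γ : Type uΓ} [AddCommGroup Γ] {A : Type uA} [CommRing A]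
    (𝒜 : Γ → AddSubgroup A) {T : Type uR} [Ring T] [Algebra A T] (𝓣 : Γ → AddSubgroup T) : Prop :=
  ∃ (l : ℕ) (n : Fin l → ℕ) (δ : ∀ i, Fin (n i) → Γ)
    (e : (∀ i, Matrix (Fin (n i)) (Fin (n i)) A) ≃ₐ[A] T),
    IsGradedAlgEquiv (matricialGrading 𝒜 δ) 𝓣 e

/-- The homogeneous components `T ∩ R_γ` of a graded subalgebra `T` of `R`. -/
def subalgebraGrading {Γ : Type uΓ} {A : Type uA} [CommRing A] {R : Type uR} [Ring R] [Algebra A R]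
    (𝓡 : Γ → AddSubgroup R) (T : Subalgebra A R) (γ : Γ) : AddSubgroup T :=
  (𝓡 γ).comap (T.val : T →+* R).toAddMonoidHom

/-- A graded `A`-algebra `R` is graded ultramatricial if it is the union of an increasing sequence
of (unital) graded `A`-subalgebras each of which is graded matricial. -/
structure IsGradedUltramatricial {Γ : Type uΓ} [AddCommGroup Γ] [DecidableEq Γ]
    {A : Type uA} [CommRing A] (𝒜 : Γ → AddSubgroup A)
    {R : Type uR} [Ring R] [Algebra A R] (𝓡 : Γ → AddSubgroup R) [GradedRing 𝓡] : Prop where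
  isGradedAlgebra : IsGradedAlgebra 𝒜 𝓡
  exists_chain : ∃ T : ℕ → Subalgebra A R, Monotone T ∧
    (∀ i, ∀ x ∈ T i, ∀ γ, (decompose 𝓡 x γ : R) ∈ T i) ∧
    (∀ i, IsGradedMatricial 𝒜 (subalgebraGrading 𝓡 (T i))) ∧
    ∀ x : R, ∃ i, x ∈ T i

/-! ### Graded finitely generated projective right modules -/

/-- A graded right `R`-module structure on the right `R`-module `M`: a decomposition
`M = ⨁ M_γ` into additive subgroups with `M_l R_γ ⊆ M_{l + γ}`. -/
structure IsGradedRightModule {Γ : Type uΓ} [AddCommGroup Γ] [DecidableEq Γ] {R : Type uR} [Ring R]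
    (𝓡 : Γ → AddSubgroup R) {M : Type uS} [AddCommGroup M] [Module Rᵐᵒᵖ M]
    (𝓜 : Γ → AddSubgroup M) : Prop where
  isInternal : DirectSum.IsInternal 𝓜
  smul_mem : ∀ (l γ : Γ) (m : M) (r : R), m ∈ 𝓜 l → r ∈ 𝓡 γ → op r • m ∈ 𝓜 (l + γ)

/-- A graded finitely generated projective right `R`-module. -/
structure GrProj {Γ : Type uΓ} [AddCommGroup Γ] [DecidableEq Γ] {R : Type uR} [Ring R]
    (𝓡 : Γ → AddSubgroup R) where
  carrier : Type uR
  [addCommGroup : AddCommGroup carrier]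
  [module : Module Rᵐᵒᵖ carrier]
  grading : Γ → AddSubgroup carrier
  isGraded : IsGradedRightModule 𝓡 grading
  finite : Module.Finite Rᵐᵒᵖ carrier
  projective : Module.Projective Rᵐᵒᵖ carrier

attribute [instance] GrProj.addCommGroup GrProj.module GrProj.finite GrProj.projective

theorem isInternal_of_subsingleton {Γ : Type uΓ} [DecidableEq Γ] {M : Type uR} [AddCommGroup M]
    [Subsingleton M] (𝓜 : Γ → AddSubgroup M) : DirectSum.IsInternal 𝓜 :=
  ⟨fun _ _ _ => DFinsupp.ext fun _ => Subtype.ext (Subsingleton.elim _ _),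
    fun _ => ⟨0, Subsingleton.elim _ _⟩⟩

/-- The componentwise grading `(M ⊕ N)_γ = M_γ ⊕ N_γ`. -/
theorem isInternal_prod {Γ : Type uΓ} [DecidableEq Γ] {M : Type uR} [AddCommGroup M]
    {N : Type uS} [AddCommGroup N] {𝓜 : Γ → AddSubgroup M} {𝓝 : Γ → AddSubgroup N}
    (hM : DirectSum.IsInternal 𝓜) (hN : DirectSum.IsInternal 𝓝) :
    DirectSum.IsInternal (fun γ => (𝓜 γ).prod (𝓝 γ)) := by
  let φ : (⨁ γ, 𝓜 γ) →+ ⨁ γ, ((𝓜 γ).prod (𝓝 γ)) :=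
    DirectSum.map fun γ =>
      ((AddMonoidHom.inl M N).comp (𝓜 γ).subtype).codRestrict ((𝓜 γ).prod (𝓝 γ))
        fun x => ⟨x.2, zero_mem _⟩
  let ψ : (⨁ γ, 𝓝 γ) →+ ⨁ γ, ((𝓜 γ).prod (𝓝 γ)) :=
    DirectSum.map fun γ =>
      ((AddMonoidHom.inr M N).comp (𝓝 γ).subtype).codRestrict ((𝓜 γ).prod (𝓝 γ))
        fun x => ⟨zero_mem _, x.2⟩
  let p : (⨁ γ, ((𝓜 γ).prod (𝓝 γ))) →+ ⨁ γ, 𝓜 γ :=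
    DirectSum.map fun γ =>
      ((AddMonoidHom.fst M N).comp ((𝓜 γ).prod (𝓝 γ)).subtype).codRestrict (𝓜 γ)
        fun x => x.2.1
  let q : (⨁ γ, ((𝓜 γ).prod (𝓝 γ))) →+ ⨁ γ, 𝓝 γ :=
    DirectSum.map fun γ =>
      ((AddMonoidHom.snd M N).comp ((𝓜 γ).prod (𝓝 γ)).subtype).codRestrict (𝓝 γ)
        fun x => x.2.2
  have hpq : ∀ z, φ (p z) + ψ (q z) = z := by
    intro z
    have : (φ.comp p + ψ.comp q) = AddMonoidHom.id _ := by
      refine DirectSum.addHom_ext fun γ y => ?_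
      simp only [AddMonoidHom.add_apply, AddMonoidHom.comp_apply, AddMonoidHom.id_apply, φ, ψ, p, q,
        DirectSum.map_of]
      rw [← map_add]
      congr 1
      exact Subtype.ext (Prod.ext (add_zero _) (zero_add _))
    exact DFunLike.congr_fun this z
  have hfst : ∀ z, DirectSum.coeAddMonoidHom 𝓜 (p z) =
      (DirectSum.coeAddMonoidHom (fun γ => (𝓜 γ).prod (𝓝 γ)) z).1 := by
    intro z
    have : (DirectSum.coeAddMonoidHom 𝓜).comp p =
        (AddMonoidHom.fst M N).comp (DirectSum.coeAddMonoidHom (fun γ => (𝓜 γ).prod (𝓝 γ))) := by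
      refine DirectSum.addHom_ext fun γ y => ?_
      simp only [p, AddMonoidHom.comp_apply, DirectSum.map_of, DirectSum.coeAddMonoidHom_of]
      rfl
    exact DFunLike.congr_fun this z
  have hsnd : ∀ z, DirectSum.coeAddMonoidHom 𝓝 (q z) =
      (DirectSum.coeAddMonoidHom (fun γ => (𝓜 γ).prod (𝓝 γ)) z).2 := by
    intro z
    have : (DirectSum.coeAddMonoidHom 𝓝).comp q =
        (AddMonoidHom.snd M N).comp (DirectSum.coeAddMonoidHom (fun γ => (𝓜 γ).prod (𝓝 γ))) := by
      refine DirectSum.addHom_ext fun γ y => ?_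
      simp only [q, AddMonoidHom.comp_apply, DirectSum.map_of, DirectSum.coeAddMonoidHom_of]
      rfl
    exact DFunLike.congr_fun this z
  have hφ : ∀ z, DirectSum.coeAddMonoidHom (fun γ => (𝓜 γ).prod (𝓝 γ)) (φ z) =
      (DirectSum.coeAddMonoidHom 𝓜 z, 0) := by
    intro z
    have : (DirectSum.coeAddMonoidHom (fun γ => (𝓜 γ).prod (𝓝 γ))).comp φ =
        (AddMonoidHom.inl M N).comp (DirectSum.coeAddMonoidHom 𝓜) := by
      refine DirectSum.addHom_ext fun γ y => ?_
      simp only [φ, AddMonoidHom.comp_apply, DirectSum.map_of, DirectSum.coeAddMonoidHom_of]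
      rfl
    exact DFunLike.congr_fun this z
  have hψ : ∀ z, DirectSum.coeAddMonoidHom (fun γ => (𝓜 γ).prod (𝓝 γ)) (ψ z) =
      (0, DirectSum.coeAddMonoidHom 𝓝 z) := by
    intro z
    have : (DirectSum.coeAddMonoidHom (fun γ => (𝓜 γ).prod (𝓝 γ))).comp ψ =
        (AddMonoidHom.inr M N).comp (DirectSum.coeAddMonoidHom 𝓝) := by
      refine DirectSum.addHom_ext fun γ y => ?_
      simp only [ψ, AddMonoidHom.comp_apply, DirectSum.map_of, DirectSum.coeAddMonoidHom_of]
      rfl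
    exact DFunLike.congr_fun this z
  constructor
  · intro z w hzw
    rw [← hpq z, ← hpq w]
    congr 2
    · exact hM.1 (by rw [hfst, hfst, hzw])
    · exact hN.1 (by rw [hsnd, hsnd, hzw])
  · rintro ⟨m, n⟩
    obtain ⟨a, ha⟩ := hM.2 m
    obtain ⟨b, hb⟩ := hN.2 n
    refine ⟨φ a + ψ b, ?_⟩
    rw [map_add, hφ, hψ, ha, hb]
    simp

/-- Reindexing a decomposition along a translation of the index group. -/
theorem isInternal_shift {Γ : Type uΓ} [AddCommGroup Γ] [DecidableEq Γ] {M : Type uR}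
    [AddCommGroup M] {𝓜 : Γ → AddSubgroup M} (hM : DirectSum.IsInternal 𝓜) (α : Γ) :
    DirectSum.IsInternal (fun γ => 𝓜 (α + γ)) := by
  have hof : ∀ (i j : Γ) (h : i = j) (x : M) (hi : x ∈ 𝓜 (α + i)) (hj : x ∈ 𝓜 (α + j)),
      DirectSum.of (fun γ => 𝓜 (α + γ)) i ⟨x, hi⟩ = DirectSum.of (fun γ => 𝓜 (α + γ)) j ⟨x, hj⟩ := by
    rintro i _ rfl x hi hj
    rfl
  let F : (⨁ γ, 𝓜 (α + γ)) →+ ⨁ γ, 𝓜 γ :=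
    DirectSum.toAddMonoid fun γ => DirectSum.of (fun γ => 𝓜 γ) (α + γ)
  let G : (⨁ γ, 𝓜 γ) →+ ⨁ γ, 𝓜 (α + γ) :=
    DirectSum.toAddMonoid fun γ => (DirectSum.of (fun γ => 𝓜 (α + γ)) (-α + γ)).comp
      (AddSubgroup.inclusion (by rw [add_neg_cancel_left]))
  have hGF : ∀ z, G (F z) = z := by
    intro z
    have : G.comp F = AddMonoidHom.id _ := by
      refine DirectSum.addHom_ext fun γ y => ?_
      simp only [F, G, AddMonoidHom.comp_apply, DirectSum.toAddMonoid_of, AddMonoidHom.id_apply]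
      exact hof _ _ (neg_add_cancel_left α γ) _ _ _
    exact DFunLike.congr_fun this z
  have hF : ∀ z, DirectSum.coeAddMonoidHom 𝓜 (F z) =
      DirectSum.coeAddMonoidHom (fun γ => 𝓜 (α + γ)) z := by
    intro z
    have : (DirectSum.coeAddMonoidHom 𝓜).comp F =
        DirectSum.coeAddMonoidHom (fun γ => 𝓜 (α + γ)) := by
      refine DirectSum.addHom_ext fun γ y => ?_
      simp only [F, AddMonoidHom.comp_apply, DirectSum.toAddMonoid_of,
        DirectSum.coeAddMonoidHom_of]
    exact DFunLike.congr_fun this z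
  have hG : ∀ z, DirectSum.coeAddMonoidHom (fun γ => 𝓜 (α + γ)) (G z) =
      DirectSum.coeAddMonoidHom 𝓜 z := by
    intro z
    have : (DirectSum.coeAddMonoidHom (fun γ => 𝓜 (α + γ))).comp G =
        DirectSum.coeAddMonoidHom 𝓜 := by
      refine DirectSum.addHom_ext fun γ y => ?_
      simp only [G, AddMonoidHom.comp_apply, DirectSum.toAddMonoid_of,
        DirectSum.coeAddMonoidHom_of]
      rfl
    exact DFunLike.congr_fun this z
  constructor
  · intro z w hzw
    rw [← hGF z, ← hGF w]
    congr 1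
    exact hM.1 (by rw [hF, hF, hzw])
  · intro m
    obtain ⟨a, ha⟩ := hM.2 m
    exact ⟨G a, by rw [hG, ha]⟩

namespace GrProj

variable {Γ : Type uΓ} [AddCommGroup Γ] [DecidableEq Γ] {R : Type uR} [Ring R]

section
variable {𝓡 : Γ → AddSubgroup R}

/-- Graded isomorphism of graded right modules. -/
def Iso (P Q : GrProj 𝓡) : Prop :=
  ∃ e : P.carrier ≃ₗ[Rᵐᵒᵖ] Q.carrier, ∀ γ x, x ∈ P.grading γ ↔ e x ∈ Q.grading γ

theorem Iso.refl (P : GrProj 𝓡) : Iso P P := ⟨LinearEquiv.refl _ _, fun _ _ => Iff.rfl⟩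

theorem Iso.symm {P Q : GrProj 𝓡} : Iso P Q → Iso Q P := fun ⟨e, he⟩ =>
  ⟨e.symm, fun γ x => by rw [he γ (e.symm x), LinearEquiv.apply_symm_apply]⟩

theorem Iso.trans {P Q T : GrProj 𝓡} : Iso P Q → Iso Q T → Iso P T := fun ⟨e, he⟩ ⟨f, hf⟩ =>
  ⟨e.trans f, fun γ x => by rw [he, hf]; rfl⟩

instance setoid (𝓡 : Γ → AddSubgroup R) : Setoid (GrProj 𝓡) :=
  ⟨Iso, Iso.refl, Iso.symm, Iso.trans⟩

/-- The direct sum `P ⊕ Q`, with `(P ⊕ Q)_γ = P_γ ⊕ Q_γ`. -/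
def sum (P Q : GrProj 𝓡) : GrProj 𝓡 where
  carrier := P.carrier × Q.carrier
  grading := fun γ => (P.grading γ).prod (Q.grading γ)
  isGraded :=
    ⟨isInternal_prod P.isGraded.isInternal Q.isGraded.isInternal,
      fun l γ m r hm hr => ⟨P.isGraded.smul_mem l γ m.1 r hm.1 hr,
        Q.isGraded.smul_mem l γ m.2 r hm.2 hr⟩⟩
  finite := inferInstance
  projective := inferInstance

/-- The zero module. -/
def zero (𝓡 : Γ → AddSubgroup R) : GrProj 𝓡 where
  carrier := PUnit.{uR + 1}
  grading := fun _ => ⊤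
  isGraded := ⟨isInternal_of_subsingleton _, fun _ _ _ _ _ _ => trivial⟩
  finite := inferInstance
  projective := inferInstance

/-- The shifted module `P(α)`, with `P(α)_γ = P_{α + γ}`. -/
def shift (α : Γ) (P : GrProj 𝓡) : GrProj 𝓡 where
  carrier := P.carrier
  grading := fun γ => P.grading (α + γ)
  isGraded := ⟨isInternal_shift P.isGraded.isInternal α, fun l γ m r hm hr => by
    rw [← add_assoc]; exact P.isGraded.smul_mem (α + l) γ m r hm hr⟩
  finite := inferInstance
  projective := inferInstance

end

/-- The ring `R` as a graded right module over itself. -/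
def regular (𝓡 : Γ → AddSubgroup R) [GradedRing 𝓡] : GrProj 𝓡 where
  carrier := R
  grading := 𝓡
  isGraded := ⟨Decomposition.isInternal 𝓡, fun _ _ _ _ hm hr => SetLike.mul_mem_graded hm hr⟩
  finite := ⟨⟨{1}, by
    rw [eq_top_iff]
    intro x _
    have h := Submodule.smul_mem (Submodule.span Rᵐᵒᵖ ((({1} : Finset R) : Set R))) (op x)
      (Submodule.subset_span (by simp : (1 : R) ∈ (({1} : Finset R) : Set R)))
    simpa using h⟩⟩
  projective := Module.Projective.of_equiv
    ({ opAddEquiv.symm with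
        map_smul' := fun a b => by simp } : Rᵐᵒᵖ ≃ₗ[Rᵐᵒᵖ] R)

end GrProj

/-! ### The monoid of graded isomorphism classes and the graded Grothendieck group -/

/-- `𝒱^gr(R)`, the set of graded isomorphism classes of graded finitely generated projective right
`R`-modules. -/
def Vgr {Γ : Type uΓ} [AddCommGroup Γ] [DecidableEq Γ] {R : Type uR} [Ring R]
    (𝓡 : Γ → AddSubgroup R) : Type (max uΓ (uR + 1)) :=
  Quotient (GrProj.setoid 𝓡)

namespace Vgr

variable {Γ : Type uΓ} [AddCommGroup Γ] [DecidableEq Γ] {R : Type uR} [Ring R]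
  {𝓡 : Γ → AddSubgroup R}

/-- The class `[P]` in `𝒱^gr(R)`. -/
def mk (P : GrProj 𝓡) : Vgr 𝓡 := Quotient.mk _ P

instance : Zero (Vgr 𝓡) := ⟨mk (GrProj.zero 𝓡)⟩

/-- `[P] + [Q] = [P ⊕ Q]`. -/
instance : Add (Vgr 𝓡) :=
  ⟨Quotient.map₂ GrProj.sum fun _ _ ⟨e, he⟩ _ _ ⟨f, hf⟩ =>
    ⟨e.prodCongr f, fun γ x => and_congr (he γ x.1) (hf γ x.2)⟩⟩

instance : AddCommMonoid (Vgr 𝓡) where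
  add_assoc := by
    rintro ⟨P⟩ ⟨Q⟩ ⟨T⟩
    exact Quotient.sound ⟨LinearEquiv.prodAssoc _ _ _ _, fun γ x => and_assoc⟩
  zero_add := by
    rintro ⟨P⟩
    exact Quotient.sound ⟨LinearEquiv.uniqueProd (R := Rᵐᵒᵖ) (M := P.carrier) (M₂ := PUnit.{uR + 1}),
      fun γ x => and_iff_right trivial⟩
  add_zero := by
    rintro ⟨P⟩
    exact Quotient.sound ⟨LinearEquiv.prodUnique (R := Rᵐᵒᵖ) (M := P.carrier) (M₂ := PUnit.{uR + 1}),
      fun γ x => and_iff_left trivial⟩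
  add_comm := by
    rintro ⟨P⟩ ⟨Q⟩
    exact Quotient.sound ⟨LinearEquiv.prodComm _ _ _, fun γ x => and_comm⟩
  nsmul := nsmulRec

/-- The action of `α ∈ Γ` on `𝒱^gr(R)`, `[P] ↦ [P(α)]`. -/
def shift (α : Γ) : Vgr 𝓡 →+ Vgr 𝓡 where
  toFun := Quotient.map (GrProj.shift α) fun _ _ ⟨e, he⟩ => ⟨e, fun γ x => he (α + γ) x⟩
  map_zero' := Quotient.sound (GrProj.Iso.refl _)
  map_add' := by
    rintro ⟨P⟩ ⟨Q⟩
    rfl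

theorem shift_zero (x : Vgr 𝓡) : shift 0 x = x := by
  obtain ⟨P⟩ := x
  exact Quotient.sound ⟨LinearEquiv.refl _ _, fun γ x => by
    change x ∈ P.grading (0 + γ) ↔ x ∈ P.grading γ
    rw [zero_add]⟩

theorem shift_add (α β : Γ) (x : Vgr 𝓡) : shift (α + β) x = shift α (shift β x) := by
  obtain ⟨P⟩ := x
  exact Quotient.sound ⟨LinearEquiv.refl _ _, fun γ x => by
    change x ∈ P.grading (α + β + γ) ↔ x ∈ P.grading (β + (α + γ))
    rw [add_comm α β, add_assoc]⟩

end Vgr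

/-- The graded Grothendieck group `K₀^gr(R)`: the group completion of `𝒱^gr(R)`. -/
def K0gr {Γ : Type uΓ} [AddCommGroup Γ] [DecidableEq Γ] {R : Type uR} [Ring R]
    (𝓡 : Γ → AddSubgroup R) : Type (max uΓ (uR + 1)) :=
  Algebra.GrothendieckAddGroup (Vgr 𝓡)

namespace K0gr

variable {Γ : Type uΓ} [AddCommGroup Γ] [DecidableEq Γ] {R : Type uR} [Ring R]

noncomputable instance (𝓡 : Γ → AddSubgroup R) : AddCommGroup (K0gr 𝓡) :=
  inferInstanceAs (AddCommGroup (Algebra.GrothendieckAddGroup (Vgr 𝓡)))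

/-- The canonical map `𝒱^gr(R) → K₀^gr(R)`. -/
noncomputable def of (𝓡 : Γ → AddSubgroup R) : Vgr 𝓡 →+ K0gr 𝓡 :=
  Algebra.GrothendieckAddGroup.of

theorem lift_of (𝓡 : Γ → AddSubgroup R) {G : Type*} [AddCommGroup G] (f : Vgr 𝓡 →+ G)
    (x : Vgr 𝓡) : Algebra.GrothendieckAddGroup.lift f (of 𝓡 x) = f x :=
  DFunLike.congr_fun (Algebra.GrothendieckAddGroup.lift.symm_apply_apply f) x

/-- The action of `Γ` on `K₀^gr(R)` induced by `α • [P] = [P(α)]`. -/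
noncomputable def shift (𝓡 : Γ → AddSubgroup R) : Multiplicative Γ →* AddMonoid.End (K0gr 𝓡) where
  toFun α := Algebra.GrothendieckAddGroup.lift ((of 𝓡).comp (Vgr.shift α.toAdd))
  map_one' := by
    refine Algebra.GrothendieckAddGroup.lift.symm.injective ?_
    rw [Equiv.symm_apply_apply]
    ext x
    exact congrArg (of 𝓡) (Vgr.shift_zero x)
  map_mul' α β := by
    refine Algebra.GrothendieckAddGroup.lift.symm.injective ?_
    rw [Equiv.symm_apply_apply]
    ext x
    change of 𝓡 (Vgr.shift (α.toAdd + β.toAdd) x) =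
      Algebra.GrothendieckAddGroup.lift ((of 𝓡).comp (Vgr.shift α.toAdd))
        (Algebra.GrothendieckAddGroup.lift ((of 𝓡).comp (Vgr.shift β.toAdd)) (of 𝓡 x))
    rw [lift_of, AddMonoidHom.comp_apply, lift_of, AddMonoidHom.comp_apply, Vgr.shift_add]

/-- The `ℤ[Γ]`-module structure on `K₀^gr(R)` extending the action of `Γ`. -/
noncomputable instance (𝓡 : Γ → AddSubgroup R) : Module (AddMonoidAlgebra ℤ Γ) (K0gr 𝓡) :=
  Module.compHom (K0gr 𝓡)
    (AddMonoidAlgebra.lift ℤ (AddMonoid.End (K0gr 𝓡)) Γ (shift 𝓡)).toRingHom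

/-- `α • [P] = [P(α)]`, where `α ∈ Γ` is viewed as an element of `ℤ[Γ]`. -/
theorem single_smul_of (𝓡 : Γ → AddSubgroup R) (α : Γ) (P : GrProj 𝓡) :
    (AddMonoidAlgebra.single α 1 : AddMonoidAlgebra ℤ Γ) • of 𝓡 (Vgr.mk P) =
      of 𝓡 (Vgr.mk (P.shift α)) := by
  change (AddMonoidAlgebra.lift ℤ (AddMonoid.End (K0gr 𝓡)) Γ (shift 𝓡)
    (AddMonoidAlgebra.single α 1)) (of 𝓡 (Vgr.mk P)) = _
  rw [AddMonoidAlgebra.lift_single, one_smul]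
  exact lift_of 𝓡 _ _

/-- The positive cone `K₀^gr(R)₊`: the image of `𝒱^gr(R)`, i.e. the set of classes `[P]`. It is the
set of elements `≥ 0` of the pre-order on `K₀^gr(R)`. -/
noncomputable def positiveCone (𝓡 : Γ → AddSubgroup R) : AddSubmonoid (K0gr 𝓡) :=
  AddMonoidHom.mrange (of 𝓡)

/-- The class `[R]` of the regular right module. -/
noncomputable def unitClass (𝓡 : Γ → AddSubgroup R) [GradedRing 𝓡] : K0gr 𝓡 :=
  of 𝓡 (Vgr.mk (GrProj.regular 𝓡))

end K0gr

/-! This is Elliott's classification of ultramatricial algebras in graded form. One direction is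
functoriality: a graded isomorphism transports modules, shifts and the regular module. The converse
rests on cancellation, on an existence and a uniqueness result for graded homomorphisms out of a
matricial algebra, and on an intertwining argument.

Cancellation: the degree-zero part of an ultramatricial algebra has stable range one, so the class
monoid embeds in its group completion (`K0gr.of_injective`). An order isomorphism of the graded
Grothendieck groups therefore restricts to an isomorphism `g` of class monoids commuting with shifts
and matching the regular modules.

After that, the argument is about the modules `e R` with `e` a degree-zero idempotent. Two such
modules agree up to a shift by `α` exactly when the idempotents are `u v` and `v u` with `u`, `v` of
degrees `-α` and `α`, and a direct sum decomposition of `e R` is an orthogonal decomposition of `e`.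

Existence (`exists_isCompatible_blockUnit`): `g` is induced, on any matricial stage of `R`, by a
graded homomorphism to `S`. Because `g` sends `[R]` to `[S]`, the images of the classes of the
diagonal matrix units are realised by orthogonal idempotents of `S` itself with sum `1`, and
shift-equivariance supplies the off-diagonal units in the right degrees. Uniqueness
(`exists_conj_of_isClass`): two graded homomorphisms giving the same classes differ by conjugation
by a degree-zero unit.

Combining the two, a homomorphism inducing `g` from a stage of `R` into a stage of `S` has a left
inverse inducing the inverse of `g` (`exists_leftInverse_of_isCompatible`). Alternating between the
two algebras produces intertwined sequences whose limit is the isomorphism. -/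

/-! ### Graded modules represented by homogeneous idempotents -/

/-- A retract of a graded abelian group, with the induced grading, is graded. -/
theorem isInternal_comap_of_retract {Γ : Type*} [DecidableEq Γ] {M N : Type*} [AddCommGroup M]
    [AddCommGroup N] {𝓜 : Γ → AddSubgroup M} (hM : DirectSum.IsInternal 𝓜) (i : N →+ M)
    (r : M →+ N) (hri : ∀ x, r (i x) = x) (hr : ∀ γ x, x ∈ 𝓜 γ → i (r x) ∈ 𝓜 γ) :
    DirectSum.IsInternal fun γ => (𝓜 γ).comap i := by
  let I : (⨁ γ, (𝓜 γ).comap i) →+ ⨁ γ, 𝓜 γ :=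
    DirectSum.map fun γ => (i.comp ((𝓜 γ).comap i).subtype).codRestrict (𝓜 γ) fun x => x.2
  let P : (⨁ γ, 𝓜 γ) →+ ⨁ γ, (𝓜 γ).comap i :=
    DirectSum.map fun γ => (r.comp (𝓜 γ).subtype).codRestrict ((𝓜 γ).comap i)
      fun x => hr γ x x.2
  have hPI : ∀ z, P (I z) = z := by
    intro z
    have : P.comp I = AddMonoidHom.id _ := by
      refine DirectSum.addHom_ext fun γ y => ?_
      simp only [I, P, AddMonoidHom.comp_apply, DirectSum.map_of, AddMonoidHom.id_apply]
      congr 1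
      exact Subtype.ext (hri _)
    exact DFunLike.congr_fun this z
  have hI : ∀ z, DirectSum.coeAddMonoidHom 𝓜 (I z) =
      i (DirectSum.coeAddMonoidHom (fun γ => (𝓜 γ).comap i) z) := by
    intro z
    have : (DirectSum.coeAddMonoidHom 𝓜).comp I =
        i.comp (DirectSum.coeAddMonoidHom (fun γ => (𝓜 γ).comap i)) := by
      refine DirectSum.addHom_ext fun γ y => ?_
      simp only [I, AddMonoidHom.comp_apply, DirectSum.map_of, DirectSum.coeAddMonoidHom_of]
      rfl
    exact DFunLike.congr_fun this z
  have hP : ∀ z, DirectSum.coeAddMonoidHom (fun γ => (𝓜 γ).comap i) (P z) =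
      r (DirectSum.coeAddMonoidHom 𝓜 z) := by
    intro z
    have : (DirectSum.coeAddMonoidHom (fun γ => (𝓜 γ).comap i)).comp P =
        r.comp (DirectSum.coeAddMonoidHom 𝓜) := by
      refine DirectSum.addHom_ext fun γ y => ?_
      simp only [P, AddMonoidHom.comp_apply, DirectSum.map_of, DirectSum.coeAddMonoidHom_of]
      rfl
    exact DFunLike.congr_fun this z
  constructor
  · intro z w hzw
    rw [← hPI z, ← hPI w]
    congr 1
    exact hM.1 (by rw [hI, hI, hzw])
  · intro x
    obtain ⟨z, hz⟩ := hM.2 (i x)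
    exact ⟨P z, by rw [hP, hz, hri]⟩

namespace GrProj

variable {Γ : Type uΓ} [AddCommGroup Γ] [DecidableEq Γ] {R : Type uR} [Ring R]
  {𝓡 : Γ → AddSubgroup R}

/-- Graded linear maps, mutually inverse, give a graded isomorphism. -/
theorem Iso.of_linearMap {P Q : GrProj 𝓡} (f : P.carrier →ₗ[Rᵐᵒᵖ] Q.carrier)
    (g : Q.carrier →ₗ[Rᵐᵒᵖ] P.carrier) (hf : ∀ γ x, x ∈ P.grading γ → f x ∈ Q.grading γ)
    (hg : ∀ γ x, x ∈ Q.grading γ → g x ∈ P.grading γ) (hfg : ∀ x, f (g x) = x)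
    (hgf : ∀ x, g (f x) = x) : Iso P Q :=
  ⟨LinearEquiv.ofLinearMap f g (LinearMap.ext hfg) (LinearMap.ext hgf), fun γ x =>
    ⟨hf γ x, fun h => by simpa [hgf] using hg γ _ h⟩⟩

/-- `P` is isomorphic to `e R`, expressed by a generator `p` of `P` (the image of `e`) and the
embedding `q` of `P` into `R`. -/
def IsRep (P : GrProj 𝓡) (e : R) : Prop :=
  ∃ (p : P.carrier) (q : P.carrier →ₗ[Rᵐᵒᵖ] R), p ∈ P.grading 0 ∧
    (∀ γ x, x ∈ P.grading γ → q x ∈ 𝓡 γ) ∧ q p = e ∧ ∀ x, op (q x) • p = x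

theorem IsRep.of_iso {P Q : GrProj 𝓡} {e : R} (h : P.IsRep e) (hPQ : Iso P Q) : Q.IsRep e := by
  obtain ⟨p, q, hp, hq, hqp, hpq⟩ := h
  obtain ⟨f, hf⟩ := hPQ
  refine ⟨f p, q ∘ₗ f.symm.toLinearMap, (hf _ _).1 hp, fun γ x hx => hq γ _ ?_, by simpa using hqp,
    fun x => ?_⟩
  · rw [hf]
    simpa using hx
  · rw [← map_smul]
    simp [hpq]

/-- The inverse isomorphisms are `x ↦ p' q(x)` and `y ↦ p q'(y)`; the composites are identities
because `q p` and `q' p'` are the same idempotent, and the maps preserve degrees because `p` and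
`p'` have degree zero. -/
theorem IsRep.iso {P Q : GrProj 𝓡} {e : R} (hP : P.IsRep e) (hQ : Q.IsRep e) : Iso P Q := by
  obtain ⟨p, q, hp, hq, hqp, hpq⟩ := hP
  obtain ⟨p', q', hp', hq', hqp', hpq'⟩ := hQ
  let f : P.carrier →ₗ[Rᵐᵒᵖ] Q.carrier :=
    { toFun := fun x => op (q x) • p'
      map_add' := fun x y => by rw [map_add, op_add, add_smul]
      map_smul' := fun r x => by
        rw [map_smul, RingHom.id_apply, smul_smul]
        congr 1 }
  let g : Q.carrier →ₗ[Rᵐᵒᵖ] P.carrier :=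
    { toFun := fun x => op (q' x) • p
      map_add' := fun x y => by rw [map_add, op_add, add_smul]
      map_smul' := fun r x => by
        rw [map_smul, RingHom.id_apply, smul_smul]
        congr 1 }
  refine Iso.of_linearMap f g (fun γ x hx => ?_) (fun γ x hx => ?_) (fun x => ?_) fun x => ?_
  · have := Q.isGraded.smul_mem 0 γ p' _ hp' (hq γ x hx)
    rwa [zero_add] at this
  · have := P.isGraded.smul_mem 0 γ p _ hp (hq' γ x hx)
    rwa [zero_add] at this
  · change op (q (op (q' x) • p)) • p' = x
    rw [map_smul, hqp, ← hqp', ← map_smul, hpq', hpq']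
  · change op (q' (op (q x) • p')) • p = x
    rw [map_smul, hqp', ← hqp, ← map_smul, hpq, hpq]

theorem isRep_regular [GradedRing 𝓡] : (regular 𝓡).IsRep 1 :=
  ⟨(1 : R), LinearMap.id, SetLike.one_mem_graded 𝓡, fun _ _ h => h, rfl, fun x => one_mul (M := R) x⟩

theorem isRep_zero : (zero 𝓡).IsRep 0 :=
  ⟨PUnit.unit, 0, trivial, fun _ _ _ => zero_mem _, rfl, fun _ => rfl⟩

/-- The module `e R` is realised as the fixed points of left multiplication by `e`. It is a graded
retract of the regular module, which gives the grading, finiteness and projectivity. -/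
theorem exists_isRep [GradedRing 𝓡] {e : R} (he : e ∈ 𝓡 0) (hee : e * e = e) :
    ∃ P : GrProj 𝓡, P.IsRep e := by
  let M : Submodule Rᵐᵒᵖ R :=
    { carrier := {x | e * x = x}
      add_mem' := fun {x y} hx hy => by
        simp only [Set.mem_ofPred_eq] at *
        rw [mul_add, hx, hy]
      zero_mem' := mul_zero e
      smul_mem' := fun r x hx => by
        simp only [Set.mem_ofPred_eq] at *
        change e * (x * unop r) = x * unop r
        rw [← mul_assoc, hx] }
  let r : R →ₗ[Rᵐᵒᵖ] M :=
    { toFun := fun x => ⟨e * x, by change e * (e * x) = e * x; rw [← mul_assoc, hee]⟩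
      map_add' := fun x y => Subtype.ext (mul_add _ _ _)
      map_smul' := fun s x => Subtype.ext (by
        change e * (x * unop s) = e * x * unop s
        rw [mul_assoc]) }
  have hr : ∀ x : M, r x = x := fun x => Subtype.ext x.2
  have hreg := (regular 𝓡).finite
  have hproj := (regular 𝓡).projective
  change Module.Finite Rᵐᵒᵖ R at hreg
  change Module.Projective Rᵐᵒᵖ R at hproj
  let P : GrProj 𝓡 :=
    { carrier := M
      grading := fun γ => (𝓡 γ).comap M.subtype.toAddMonoidHom
      isGraded := ⟨isInternal_comap_of_retract (Decomposition.isInternal 𝓡)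
        M.subtype.toAddMonoidHom r.toAddMonoidHom hr fun γ x hx => by
          change e * x ∈ 𝓡 γ
          simpa using SetLike.mul_mem_graded he hx,
        fun l γ m s hm hs => by
          change (m : R) * s ∈ 𝓡 (l + γ)
          exact SetLike.mul_mem_graded hm hs⟩
      finite := Module.Finite.of_surjective r fun x => ⟨x, hr x⟩
      projective := Module.Projective.of_split M.subtype r (LinearMap.ext hr) }
  refine ⟨P, (⟨e, hee⟩ : M), M.subtype, he, fun _ _ h => h, rfl, fun x => Subtype.ext x.2⟩

/-- Graded Murray–von Neumann equivalence: an isomorphism between `e' R` shifted by `α` and `e R` is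
left multiplication by `u`, with inverse left multiplication by `v`. The shift is visible only in
the degrees of `u` and `v`. -/
theorem isRep_shift_iff [GradedRing 𝓡] {P : GrProj 𝓡} {e' : R} (hP : P.IsRep e') (α : Γ) (e : R) :
    (P.shift α).IsRep e ↔ ∃ u ∈ 𝓡 (-α), ∃ v ∈ 𝓡 α, u * e' = u ∧ e * u = u ∧ v * e = v ∧
      e' * v = v ∧ u * v = e ∧ v * u = e' := by
  obtain ⟨p', q', hp', hq', hqp', hpq'⟩ := hP
  constructor
  · rintro ⟨p, q, hp, hq, hqp, hpq⟩
    change P.carrier →ₗ[Rᵐᵒᵖ] R at q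
    change P.carrier at p
    change ∀ γ x, x ∈ P.grading (α + γ) → q x ∈ 𝓡 γ at hq
    change p ∈ P.grading (α + 0) at hp
    change q p = e at hqp
    change ∀ x : P.carrier, op (q x) • p = x at hpq
    have key : ∀ (f : P.carrier →ₗ[Rᵐᵒᵖ] R) x r, f x * r = f (op r • x) := fun f x r => by
      rw [map_smul]; rfl
    refine ⟨q p', hq _ _ (by simpa using hp'), q' p, hq' _ _ (by simpa using hp), ?_, ?_, ?_, ?_,
      ?_, ?_⟩
    · rw [key, ← hqp', hpq']
    · rw [← hqp, key, hpq]
    · rw [key, ← hqp, hpq]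
    · rw [← hqp', key, hpq']
    · rw [key, hpq', hqp]
    · rw [key, hpq, hqp']
  · rintro ⟨u, hu, v, hv, h1, h2, h3, h4, h5, h6⟩
    let q : P.carrier →ₗ[Rᵐᵒᵖ] R :=
      { toFun := fun x => u * q' x
        map_add' := fun x y => by rw [map_add, mul_add]
        map_smul' := fun r x => by
          rw [map_smul]
          exact (mul_assoc _ _ _).symm }
    refine ⟨(op v • p' : P.carrier), q, ?_, fun γ x hx => ?_, ?_, fun x => ?_⟩
    · change op v • p' ∈ P.grading (α + 0)
      simpa using P.isGraded.smul_mem 0 α p' v hp' hv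
    · change u * q' x ∈ 𝓡 γ
      have := SetLike.mul_mem_graded hu (hq' (α + γ) x hx)
      rwa [neg_add_cancel_left] at this
    · change u * q' (op v • p') = e
      rw [map_smul, hqp']
      change u * (e' * v) = e
      rw [h4, h5]
    · change op (u * q' x) • op v • p' = x
      rw [smul_smul, ← op_mul, ← mul_assoc, h6, op_mul, mul_smul, ← hqp', hpq']
      exact hpq' x

theorem isRep_sum_of_isRep {P Q : GrProj 𝓡} {e f : R} (hP : P.IsRep e) (hQ : Q.IsRep f)
    (hef : e * f = 0) (hfe : f * e = 0) : (P.sum Q).IsRep (e + f) := by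
  obtain ⟨p, q, hp, hq, hqp, hpq⟩ := hP
  obtain ⟨p', q', hp', hq', hqp', hpq'⟩ := hQ
  have key : ∀ y, op (q' y) • p = 0 := fun y => by
    rw [← hpq p, hqp, ← hpq' y, map_smul, hqp', smul_smul]
    change op (e * (f * q' y)) • p = 0
    rw [← mul_assoc, hef, zero_mul, op_zero, zero_smul]
  have key' : ∀ y, op (q y) • p' = 0 := fun y => by
    rw [← hpq' p', hqp', ← hpq y, map_smul, hqp, smul_smul]
    change op (f * (e * q y)) • p' = 0
    rw [← mul_assoc, hfe, zero_mul, op_zero, zero_smul]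
  refine ⟨((p, p') : P.carrier × Q.carrier), q.coprod q', ⟨hp, hp'⟩,
    fun γ x hx => add_mem (hq _ _ hx.1) (hq' _ _ hx.2), ?_, fun x => Prod.ext ?_ ?_⟩
  · change q p + q' p' = e + f
    rw [hqp, hqp']
  · change op (q x.1 + q' x.2) • p = x.1
    rw [op_add, add_smul, hpq, key, add_zero]
  · change op (q x.1 + q' x.2) • p' = x.2
    rw [op_add, add_smul, hpq', key', zero_add]

/-- The generator of the sum is a pair `(p, p')`, and the embedding `q` sends `(p, 0)` and `(0, p')`
to the two orthogonal idempotents. -/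
theorem IsRep.exists_of_sum {P Q : GrProj 𝓡} {e : R} (h : (P.sum Q).IsRep e) :
    ∃ e₁ e₂, P.IsRep e₁ ∧ Q.IsRep e₂ ∧ e₁ * e₂ = 0 ∧ e₂ * e₁ = 0 ∧ e₁ + e₂ = e := by
  obtain ⟨⟨p, p'⟩, q, hp, hq, hqp, hpq⟩ := h
  change P.carrier × Q.carrier →ₗ[Rᵐᵒᵖ] R at q
  have h1 : ∀ x, op (q (x, 0)) • p = x := fun x => congrArg Prod.fst (hpq (x, 0))
  have h2 : ∀ x, op (q (x, 0)) • p' = 0 := fun x => congrArg Prod.snd (hpq (x, 0))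
  have h3 : ∀ y, op (q (0, y)) • p = 0 := fun y => congrArg Prod.fst (hpq (0, y))
  have h4 : ∀ y, op (q (0, y)) • p' = y := fun y => congrArg Prod.snd (hpq (0, y))
  have key : ∀ x r, q x * r = q (op r • x) := fun x r => by
      rw [map_smul]; rfl
  refine ⟨q (p, 0), q (0, p'), ⟨p, q ∘ₗ LinearMap.inl _ _ _, hp.1,
    fun γ x hx => hq γ _ ⟨hx, zero_mem _⟩, rfl, h1⟩, ⟨p', q ∘ₗ LinearMap.inr _ _ _, hp.2,
    fun γ x hx => hq γ _ ⟨zero_mem _, hx⟩, rfl, h4⟩, ?_, ?_, ?_⟩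
  · rw [key, Prod.smul_mk, h3, smul_zero]
    exact map_zero q
  · rw [key, Prod.smul_mk, h2, smul_zero]
    exact map_zero q
  · rw [← map_add, ← hqp]
    simp
    rfl

end GrProj

/-! ### Classes of homogeneous idempotents -/

namespace Vgr

variable {Γ : Type uΓ} [AddCommGroup Γ] [DecidableEq Γ] {R : Type uR} [Ring R]
  {𝓡 : Γ → AddSubgroup R}

/-- `x` is the class of the graded module `e R`. -/
def IsClass (x : Vgr 𝓡) (e : R) : Prop := ∃ P : GrProj 𝓡, mk P = x ∧ P.IsRep e

theorem mk_eq_mk {P Q : GrProj 𝓡} : mk P = mk Q ↔ GrProj.Iso P Q := Quotient.eq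

theorem isClass_mk {P : GrProj 𝓡} {e : R} : (mk P).IsClass e ↔ P.IsRep e :=
  ⟨fun ⟨_, hQ, h⟩ => h.of_iso (mk_eq_mk.1 hQ), fun h => ⟨P, rfl, h⟩⟩

theorem IsClass.unique {x y : Vgr 𝓡} {e : R} (hx : x.IsClass e) (hy : y.IsClass e) : x = y := by
  obtain ⟨P, rfl, hP⟩ := hx
  obtain ⟨Q, rfl, hQ⟩ := hy
  exact mk_eq_mk.2 (hP.iso hQ)

theorem exists_isClass [GradedRing 𝓡] {e : R} (he : e ∈ 𝓡 0) (hee : e * e = e) :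
    ∃ x : Vgr 𝓡, x.IsClass e :=
  let ⟨P, hP⟩ := GrProj.exists_isRep he hee
  ⟨mk P, P, rfl, hP⟩

theorem isClass_one [GradedRing 𝓡] : (mk (GrProj.regular 𝓡)).IsClass 1 :=
  ⟨_, rfl, GrProj.isRep_regular⟩

theorem isClass_zero : (0 : Vgr 𝓡).IsClass 0 := ⟨_, rfl, GrProj.isRep_zero⟩

theorem IsClass.shift_iff [GradedRing 𝓡] {x : Vgr 𝓡} {e' : R} (hx : x.IsClass e') (α : Γ) (e : R) :
    (shift α x).IsClass e ↔ ∃ u ∈ 𝓡 (-α), ∃ v ∈ 𝓡 α, u * e' = u ∧ e * u = u ∧ v * e = v ∧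
      e' * v = v ∧ u * v = e ∧ v * u = e' := by
  obtain ⟨P, rfl, hP⟩ := hx
  exact isClass_mk.trans (GrProj.isRep_shift_iff hP α e)

theorem IsClass.add {x y : Vgr 𝓡} {e f : R} (hx : x.IsClass e) (hy : y.IsClass f)
    (hef : e * f = 0) (hfe : f * e = 0) : (x + y).IsClass (e + f) := by
  obtain ⟨P, rfl, hP⟩ := hx
  obtain ⟨Q, rfl, hQ⟩ := hy
  exact ⟨_, rfl, GrProj.isRep_sum_of_isRep hP hQ hef hfe⟩

theorem IsClass.exists_of_add {x y : Vgr 𝓡} {e : R} (h : (x + y).IsClass e) :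
    ∃ e₁ e₂, x.IsClass e₁ ∧ y.IsClass e₂ ∧ e₁ * e₂ = 0 ∧ e₂ * e₁ = 0 ∧ e₁ + e₂ = e := by
  obtain ⟨P⟩ := x
  obtain ⟨Q⟩ := y
  obtain ⟨e₁, e₂, h₁, h₂, h⟩ := (isClass_mk.1 h : (P.sum Q).IsRep e).exists_of_sum
  exact ⟨e₁, e₂, isClass_mk.2 h₁, isClass_mk.2 h₂, h⟩

theorem IsClass.mul_self {x : Vgr 𝓡} {e : R} (h : x.IsClass e) : e * e = e := by
  obtain ⟨P, -, p, q, hp, hq, rfl, hpq⟩ := h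
  conv_rhs => rw [← hpq p, map_smul]
  rfl

/-- A decomposition of the class of an idempotent lifts to a decomposition of the idempotent. -/
theorem IsClass.exists_of_sum {ι : Type*} [DecidableEq ι] (s : Finset ι) (x : ι → Vgr 𝓡) {e : R}
    (h : (∑ i ∈ s, x i).IsClass e) :
    ∃ f : ι → R, (∀ i ∈ s, (x i).IsClass (f i)) ∧
      (∀ i ∈ s, ∀ j ∈ s, i ≠ j → f i * f j = 0) ∧ ∑ i ∈ s, f i = e := by
  induction s using Finset.induction_on generalizing e with
  | empty =>
    obtain ⟨p, q, -, -, rfl, -⟩ := isClass_mk.1 (h : (mk (GrProj.zero 𝓡)).IsClass e)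
    exact ⟨0, by simp, by simp, (map_zero q).symm⟩
  | insert a s ha ih =>
    rw [Finset.sum_insert ha] at h
    obtain ⟨e₁, e₂, h₁, h₂, h₁₂, h₂₁, rfl⟩ := h.exists_of_add
    obtain ⟨f, hf, hff, rfl⟩ := ih h₂
    -- Each `f i` lies under the partial sum, so it inherits orthogonality to `e₁` from that sum.
    have hs : ∀ i ∈ s, f i * (∑ j ∈ s, f j) = f i ∧ (∑ j ∈ s, f j) * f i = f i := by
      intro i hi
      rw [Finset.mul_sum, Finset.sum_mul, Finset.sum_eq_single_of_mem i hi,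
        Finset.sum_eq_single_of_mem i hi, (hf i hi).mul_self]
      · exact ⟨rfl, rfl⟩
      · exact fun j hj hji => hff j hj i hi hji
      · exact fun j hj hji => hff i hi j hj hji.symm
    have hne : ∀ i ∈ s, i ≠ a := fun i hi h => ha (h ▸ hi)
    refine ⟨Function.update f a e₁, ?_, ?_, ?_⟩
    · intro i hi
      rcases Finset.mem_insert.1 hi with rfl | hi
      · simpa using h₁
      · simpa [hne i hi] using hf i hi
    · intro i hi j hj hij
      rcases Finset.mem_insert.1 hi with hi | hi <;> rcases Finset.mem_insert.1 hj with hj | hj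
      · exact (hij (hi.trans hj.symm)).elim
      · rw [hi, Function.update_self, Function.update_of_ne (hne j hj), ← (hs j hj).2, ← mul_assoc,
          h₁₂, zero_mul]
      · rw [hj, Function.update_self, Function.update_of_ne (hne i hi), ← (hs i hi).1, mul_assoc,
          h₂₁, mul_zero]
      · rw [Function.update_of_ne (hne i hi), Function.update_of_ne (hne j hj)]
        exact hff i hi j hj hij
    · rw [Finset.sum_insert ha, Function.update_self]
      congr 1
      exact Finset.sum_congr rfl fun i hi => Function.update_of_ne (hne i hi) _ _

end Vgr

/-! ### Stable range one -/

/-- A ring has stable range one. -/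
def HasStableRangeOne (W : Type*) [Ring W] : Prop :=
  ∀ a x b z : W, a * x + b * z = 1 → ∃ y, IsUnit (a + b * y)

/-- A ring whose identity is a sum of orthogonal idempotents with division rings as corners has
stable range one. -/
theorem hasStableRangeOne_of_division_corners {W ι : Type*} [Ring W] [Fintype ι] [DecidableEq ι]
    (e : ι → W) (hee : ∀ i, e i * e i = e i) (hij : ∀ i j, i ≠ j → e i * e j = 0)
    (hsum : ∑ i, e i = 1)
    (hdiv : ∀ i d, e i * d * e i ≠ 0 → ∃ d', (e i * d * e i) * d' = e i ∧ d' * (e i * d * e i) = e i ∧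
      e i * d' = d' ∧ d' * e i = d') :
    HasStableRangeOne W := by
  -- Gaussian elimination. With `c * e l` read as column `l` of `c`, the set `s` contains the
  -- columns not yet equal to those of the identity. When `s` is empty, `c = 1`.
  have main : ∀ (s : Finset ι) (c x b z : W), c * x + b * z = 1 → (∀ l ∉ s, c * e l = e l) →
      ∃ y, IsUnit (c + b * y) := by
    intro s
    induction s using Finset.induction_on with
    | empty =>
      intro c x b z _ hc
      have : c = 1 := by
        rw [← mul_one c, ← hsum, Finset.mul_sum]
        exact Finset.sum_congr rfl fun l _ => hc l (Finset.notMem_empty l)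
      exact ⟨0, by simp [this]⟩
    | insert k s hk ih =>
      -- reduction to the case of an invertible pivot
      have pivot : ∀ (c x b z : W), c * x + b * z = 1 → (∀ l ∉ insert k s, c * e l = e l) →
          e k * c * e k ≠ 0 → ∃ y, IsUnit (c + b * y) := by
        intro c x b z hcb hc hd
        obtain ⟨d', h1, h2, h3, h4⟩ := hdiv k c hd
        set d := e k * c * e k with hdef
        have hdk : d * e k = d := by rw [hdef, mul_assoc, hee]
        have hkd : e k * d = d := by rw [hdef, ← mul_assoc, ← mul_assoc, hee]
        have hw : (1 - e k + d') * (1 - e k + d) = 1 := by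
          have : (1 - e k + d') * (1 - e k + d) =
            1 - e k - e k + e k * e k + (d - e k * d) + (d' - d' * e k) + d' * d := by noncomm_ring
          rw [this, hee, hkd, h4, h2]; abel
        have hw' : (1 - e k + d) * (1 - e k + d') = 1 := by
          have : (1 - e k + d) * (1 - e k + d') =
            1 - e k - e k + e k * e k + (d' - e k * d') + (d - d * e k) + d * d' := by noncomm_ring
          rw [this, hee, h3, hdk, h1]; abel
        -- Right multiplication by `w` normalises the pivot of column `k` to `e k`, and left
        -- multiplication by `1 - t` clears the rest of that column. Both factors are units, so the
        -- conclusion for the reduced matrix can be carried back.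
        set w := 1 - e k + d' with hwdef
        set w' := 1 - e k + d with hwdef'
        set t := (1 - e k) * c * d' with ht
        have hde : ∀ l, l ≠ k → d' * e l = 0 := fun l hl => by
          rw [← h4, mul_assoc, hij k l hl.symm, mul_zero]
        have htt : t * t = 0 := by
          have : d' * (1 - e k) = 0 := by rw [mul_sub, mul_one, h4, sub_self]
          rw [ht, show (1 - e k) * c * d' * ((1 - e k) * c * d') =
            (1 - e k) * c * (d' * (1 - e k)) * c * d' by noncomm_ring, this]
          simp
        have hu : (1 - t) * (1 + t) = 1 := by
          rw [show (1 - t) * (1 + t) = 1 - t * t by noncomm_ring, htt, sub_zero]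
        have hu' : (1 + t) * (1 - t) = 1 := by
          rw [show (1 + t) * (1 - t) = 1 - t * t by noncomm_ring, htt, sub_zero]
        have hcols : ∀ l ∉ s, (1 - t) * c * w * e l = e l := by
          intro l hl
          by_cases hlk : l = k
          · subst hlk
            have hwk : w * e l = d' := by
              rw [hwdef, add_mul, sub_mul, one_mul, hee, h4]; abel
            have hdcd : d' * c * d' = d' := by
              rw [show d' * c * d' = (d' * e l) * c * (e l * d') by rw [h3, h4],
                show d' * e l * c * (e l * d') = d' * (e l * c * e l) * d' by noncomm_ring,
                ← hdef, h2, h3]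
            have hecd : e l * c * d' = e l := by
              refine Eq.trans ?_ h1
              rw [hdef, mul_assoc (e l * c) (e l) d', h3]
            calc (1 - t) * c * w * e l = (1 - t) * c * (w * e l) := mul_assoc _ _ _
              _ = c * d' - (1 - e l) * c * (d' * c * d') := by rw [hwk, ht]; noncomm_ring
              _ = e l * c * d' := by rw [hdcd]; noncomm_ring
              _ = e l := hecd
          · have hwl : w * e l = e l := by
              rw [hwdef, add_mul, sub_mul, one_mul, hij k l (Ne.symm hlk), hde l hlk]; abel
            rw [mul_assoc _ w, hwl, mul_assoc, hc l (by simp [hl, hlk]), sub_mul, one_mul, ht,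
              mul_assoc _ d', hde l hlk, mul_zero, sub_zero]
        obtain ⟨y, hy⟩ := ih ((1 - t) * c * w) (w' * x * (1 + t)) ((1 - t) * b) (z * (1 + t)) (by
          calc _ = (1 - t) * (c * (w * w') * x + b * z) * (1 + t) := by noncomm_ring
            _ = 1 := by rw [hw, mul_one, hcb, mul_one, hu]) hcols
        refine ⟨y * w', ?_⟩
        have hU : IsUnit (1 + t) := ⟨⟨_, _, hu', hu⟩, rfl⟩
        have hW : IsUnit w' := ⟨⟨_, _, hw', hw⟩, rfl⟩
        have : c + b * (y * w') = (1 + t) * ((1 - t) * c * w + (1 - t) * b * y) * w' := by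
          calc _ = 1 * (c * 1 + b * y * w') := by noncomm_ring
            _ = (1 + t) * (1 - t) * (c * (w * w') + b * y * w') := by rw [hu', hw]
            _ = _ := by noncomm_ring
        rw [this]
        exact (hU.mul hy).mul hW
      intro c x b z hcb hc
      by_cases hk0 : e k = 0
      · refine ih c x b z hcb fun l hl => ?_
        by_cases hlk : l = k
        · rw [hlk, hk0, mul_zero]
        · exact hc l (by simp [hl, hlk])
      by_cases hd : e k * c * e k = 0
      · have htt : ((1 - e k) * x * e k) * ((1 - e k) * x * e k) = 0 := by
          rw [show ((1 - e k) * x * e k) * ((1 - e k) * x * e k) =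
            (1 - e k) * x * (e k - e k * e k) * x * e k by noncomm_ring, hee]
          simp
        set t := (1 - e k) * x * e k with ht
        have hu : (1 - t) * (1 + t) = 1 := by
          rw [show (1 - t) * (1 + t) = 1 - t * t by noncomm_ring, htt, sub_zero]
        have hu' : (1 + t) * (1 - t) = 1 := by
          rw [show (1 + t) * (1 - t) = 1 - t * t by noncomm_ring, htt, sub_zero]
        have hkt : e k * t = 0 := by
          rw [ht, show e k * ((1 - e k) * x * e k) = (e k - e k * e k) * x * e k by noncomm_ring,
            hee, sub_self, zero_mul, zero_mul]
        have hkl : ∀ l ∉ insert k s, e k * e l = 0 := fun l hl =>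
          hij k l fun h => hl (h ▸ Finset.mem_insert_self _ _)
        -- A vanishing pivot is replaced by `e k`: since `c x + b z = 1`, column `k` of the new
        -- matrix is `c e_k + e_k - c e_k x e_k`, whose diagonal part is `e_k` when `e_k c e_k = 0`.
        -- The columns already reduced are unchanged, since `e k * e l = 0` for them.
        obtain ⟨y, hy⟩ := pivot (c * (1 + t) + b * (z * e k)) ((1 - t) * x) b (z - z * e k * (1 - t) * x)
          (by
            calc _ = c * ((1 + t) * (1 - t)) * x + b * z := by noncomm_ring
              _ = 1 := by rw [hu', mul_one, hcb])
          (fun l hl => by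
            rw [show (c * (1 + t) + b * (z * e k)) * e l = c * e l + (c * (1 - e k) * x + b * z) * (e k * e l) by
              rw [ht]; noncomm_ring, hc l hl, hkl l hl, mul_zero, add_zero])
          (by
            have : e k * (c * (1 + t) + b * (z * e k)) * e k = e k := by
              calc _ = e k * c * e k - e k * c * e k * (x * (e k * e k)) +
                    e k * (c * x + b * z) * (e k * e k) := by rw [ht]; noncomm_ring
                _ = e k := by rw [hd, hee, hcb]; simp [hee]
            rw [this]
            exact hk0)
        refine ⟨(z * e k + y) * (1 - t), ?_⟩
        have hU : IsUnit (1 - t) := ⟨⟨_, _, hu, hu'⟩, rfl⟩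
        have : c + b * ((z * e k + y) * (1 - t)) =
            (c * (1 + t) + b * (z * e k) + b * y) * (1 - t) := by
          calc _ = c * 1 + b * ((z * e k + y) * (1 - t)) := by noncomm_ring
            _ = c * ((1 + t) * (1 - t)) + b * ((z * e k + y) * (1 - t)) := by rw [hu']
            _ = _ := by noncomm_ring
        rw [this]
        exact hy.mul hU
      · exact pivot c x b z hcb hc hd
  exact fun a x b z h => main Finset.univ a x b z h fun l hl => (hl (Finset.mem_univ l)).elim

/-! ### Homogeneous components of linear maps -/

section DegreeZeroPart

variable {Γ : Type uΓ} [AddCommGroup Γ] [DecidableEq Γ] {R : Type uR} [Ring R]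
  {𝓡 : Γ → AddSubgroup R}

theorem decompose_map_of_graded {Γ M N : Type*} [DecidableEq Γ] [AddCommGroup M] [AddCommGroup N]
    {𝓜 : Γ → AddSubgroup M} {𝓝 : Γ → AddSubgroup N} [Decomposition 𝓜] [Decomposition 𝓝]
    (h : M →+ N) (hh : ∀ γ x, x ∈ 𝓜 γ → h x ∈ 𝓝 γ) (γ : Γ) (x : M) :
    (decompose 𝓝 (h x) γ : N) = h (decompose 𝓜 x γ) := by
  induction x using Decomposition.inductionOn 𝓜 with
  | zero => simp
  | @homogeneous i m =>
    by_cases hi : i = γ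
    · subst hi
      rw [decompose_of_mem_same 𝓝 (hh i m m.2), decompose_of_mem_same 𝓜 m.2]
    · rw [decompose_of_mem_ne 𝓝 (hh i m m.2) hi, decompose_of_mem_ne 𝓜 m.2 hi, map_zero]
  | add m m' hm hm' => simp [decompose_add, hm, hm']

theorem IsGradedRightModule.decompose_smul {M : Type*} [AddCommGroup M] [Module Rᵐᵒᵖ M]
    {𝓜 : Γ → AddSubgroup M} (hM : IsGradedRightModule 𝓡 𝓜) [Decomposition 𝓜] {l : Γ} {r : R}
    (hr : r ∈ 𝓡 l) (γ : Γ) (x : M) :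
    (decompose 𝓜 (op r • x) (γ + l) : M) = op r • (decompose 𝓜 x γ : M) := by
  induction x using Decomposition.inductionOn 𝓜 with
  | zero => simp
  | @homogeneous i m =>
    by_cases hi : i = γ
    · subst hi
      rw [decompose_of_mem_same 𝓜 (hM.smul_mem i l m r m.2 hr), decompose_of_mem_same 𝓜 m.2]
    · rw [decompose_of_mem_ne 𝓜 (hM.smul_mem i l m r m.2 hr) fun h => hi (add_right_cancel h),
        decompose_of_mem_ne 𝓜 m.2 hi, smul_zero]
  | add m m' hm hm' => simp [decompose_add, smul_add, hm, hm']

/-- The degree zero component of a linear map between graded modules. -/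
theorem exists_degreeZeroPart [GradedRing 𝓡] {M N : Type*} [AddCommGroup M] [Module Rᵐᵒᵖ M]
    [AddCommGroup N] [Module Rᵐᵒᵖ N] {𝓜 : Γ → AddSubgroup M} {𝓝 : Γ → AddSubgroup N}
    (hM : IsGradedRightModule 𝓡 𝓜) (hN : IsGradedRightModule 𝓡 𝓝) [Decomposition 𝓜]
    [Decomposition 𝓝] (h : M →ₗ[Rᵐᵒᵖ] N) :
    ∃ h₀ : M →ₗ[Rᵐᵒᵖ] N, ∀ γ x, x ∈ 𝓜 γ → h₀ x = decompose 𝓝 (h x) γ := by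
  let c : ∀ γ, 𝓜 γ →+ 𝓝 γ := fun γ =>
    { toFun := fun x => decompose 𝓝 (h x) γ
      map_zero' := by simp
      map_add' := fun x y => by simp [decompose_add] }
  let f : M →+ N := (DirectSum.coeAddMonoidHom 𝓝).comp
    ((DirectSum.map c).comp (decomposeAddEquiv 𝓜).toAddMonoidHom)
  have hf : ∀ γ x, x ∈ 𝓜 γ → f x = decompose 𝓝 (h x) γ := by
    intro γ x hx
    change DirectSum.coeAddMonoidHom 𝓝 (DirectSum.map c (decompose 𝓜 x)) = _
    rw [decompose_of_mem 𝓜 hx, DirectSum.map_of, DirectSum.coeAddMonoidHom_of]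
    rfl
  have hsmul : ∀ (r : R) (x : M), f (op r • x) = op r • f x := by
    intro r x
    induction r using Decomposition.inductionOn 𝓡 with
    | zero => simp
    | @homogeneous l r =>
      induction x using Decomposition.inductionOn 𝓜 with
      | zero => simp
      | @homogeneous γ m =>
        rw [hf γ m m.2, hf (γ + l) _ (hM.smul_mem γ l m r m.2 r.2), map_smul,
          hN.decompose_smul r.2]
      | add m m' hm hm' => rw [smul_add, map_add, hm, hm', map_add, smul_add]
    | add r r' hr hr' => rw [op_add, add_smul, map_add, hr, hr', add_smul]
  exact ⟨{ f with map_smul' := fun r x => hsmul (unop r) x }, hf⟩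

end DegreeZeroPart

/-! ### Cancellation -/

/-- The degree zero part of a graded ring has stable range one. -/
def DegreeZeroStableRangeOne {Γ : Type uΓ} [AddCommGroup Γ] {R : Type uR} [Ring R]
    (𝓡 : Γ → AddSubgroup R) : Prop :=
  ∀ a ∈ 𝓡 0, ∀ x ∈ 𝓡 0, ∀ b ∈ 𝓡 0, a * x + b = 1 →
    ∃ y ∈ 𝓡 0, ∃ v ∈ 𝓡 0, (a + b * y) * v = 1 ∧ v * (a + b * y) = 1

/-- The linear map `R → M`, `s ↦ m s`. -/
def mulElement {R M : Type*} [Ring R] [AddCommGroup M] [Module Rᵐᵒᵖ M] (m : M) :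
    R →ₗ[Rᵐᵒᵖ] M where
  toFun s := op s • m
  map_add' s t := by rw [op_add, add_smul]
  map_smul' r s := by
    rw [RingHom.id_apply, smul_smul]
    rfl

namespace GrProj

variable {Γ : Type uΓ} [AddCommGroup Γ] [DecidableEq Γ] {R : Type uR} [Ring R]
  {𝓡 : Γ → AddSubgroup R}

/-- Schur complement: an isomorphism `X ⊕ R ≅ Y ⊕ R` whose component `R → R` is invertible induces
an isomorphism `X ≅ Y`. -/
theorem iso_of_isUnit_component [GradedRing 𝓡] {X Y : GrProj 𝓡}
    (φ : (X.carrier × R) ≃ₗ[Rᵐᵒᵖ] (Y.carrier × R))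
    (hφ : ∀ γ (x : X.carrier × R), x ∈ (X.grading γ).prod (𝓡 γ) → φ x ∈ (Y.grading γ).prod (𝓡 γ))
    (hφ' : ∀ γ (x : Y.carrier × R), x ∈ (Y.grading γ).prod (𝓡 γ) → φ.symm x ∈ (X.grading γ).prod (𝓡 γ))
    {v : R} (hv : v ∈ 𝓡 0) (huv : (φ (0, 1)).2 * v = 1) (hvu : v * (φ (0, 1)).2 = 1) :
    Iso X Y := by
  have hφs : ∀ s : R, φ (0, s) = op s • φ (0, 1) := fun s => by
    rw [← map_smul]
    congr 1
    exact Prod.ext (smul_zero _).symm (one_mul s).symm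
  let lv : R →ₗ[Rᵐᵒᵖ] R := mulElement v
  have hlv : ∀ s, lv s = v * s := fun s => rfl
  let p : X.carrier →ₗ[Rᵐᵒᵖ] Y.carrier := LinearMap.fst _ _ _ ∘ₗ φ.toLinearMap ∘ₗ LinearMap.inl _ _ _
  let r : X.carrier →ₗ[Rᵐᵒᵖ] R := LinearMap.snd _ _ _ ∘ₗ φ.toLinearMap ∘ₗ LinearMap.inl _ _ _
  have hsplit : ∀ x s, φ (x, s) = (p x + op s • (φ (0, 1)).1, r x + (φ (0, 1)).2 * s) := by
    intro x s
    have : ((x, s) : X.carrier × R) = (x, 0) + (0, s) := by simp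
    rw [this, map_add, hφs]
    rfl
  have h01 : φ (0, 1) ∈ (Y.grading 0).prod (𝓡 0) :=
    hφ 0 (0, 1) ⟨zero_mem _, SetLike.one_mem_graded 𝓡⟩
  have hr : ∀ γ x, x ∈ X.grading γ → r x ∈ 𝓡 γ := fun γ x hx => (hφ γ (x, 0) ⟨hx, zero_mem _⟩).2
  let h : X.carrier →ₗ[Rᵐᵒᵖ] Y.carrier := p - mulElement (φ (0, 1)).1 ∘ₗ lv ∘ₗ r
  -- The inverse of a Schur complement is the corresponding block of the inverse matrix.
  let h' : Y.carrier →ₗ[Rᵐᵒᵖ] X.carrier :=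
    LinearMap.fst _ _ _ ∘ₗ φ.symm.toLinearMap ∘ₗ LinearMap.inl _ _ _
  have hh : ∀ x, h x = p x - op (v * r x) • (φ (0, 1)).1 := fun x => rfl
  refine Iso.of_linearMap h h' (fun γ x hx => ?_) (fun γ y hy => ?_) (fun y => ?_) fun x => ?_
  · rw [hh]
    refine sub_mem (hφ γ (x, 0) ⟨hx, zero_mem _⟩).1 ?_
    have := Y.isGraded.smul_mem 0 (0 + γ) _ _ h01.1 (SetLike.mul_mem_graded hv (hr γ x hx))
    rwa [zero_add, zero_add] at this
  · exact (hφ' γ (y, 0) ⟨hy, zero_mem _⟩).1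
  · have h1 : φ (h' y, (φ.symm (y, 0)).2) = (y, 0) := φ.apply_symm_apply (y, 0)
    rw [hsplit] at h1
    obtain ⟨h2, h3⟩ := Prod.mk.inj h1
    have h4 : v * r (h' y) = -(φ.symm (y, 0)).2 := by
      rw [← neg_eq_iff_add_eq_zero] at h3
      rw [← one_mul (φ.symm (y, 0)).2, ← hvu, mul_assoc, ← h3, mul_neg, neg_neg]
    rw [hh, h4, op_neg, neg_smul, sub_neg_eq_add, h2]
  · have h1 : φ (x, -(v * r x)) = (h x, 0) := by
      rw [hsplit, hh, op_neg, neg_smul, mul_neg, ← mul_assoc, huv, one_mul, add_neg_cancel,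
        sub_eq_add_neg]
    change (φ.symm (h x, 0)).1 = x
    rw [← h1, LinearEquiv.symm_apply_apply]

/-- The last row of `φ` times the last column of its inverse gives an equation `a x + b = 1` in
degree zero, `a` being the component from `R` to `R`. Stable range one yields `y` with `a + b y`
invertible, and composing `φ` with a shear built from `y` turns the component into `a + b y`. The
Schur complement then applies. -/
theorem Iso.of_sum_regular [GradedRing 𝓡] (h𝓡 : DegreeZeroStableRangeOne 𝓡) {X Y : GrProj 𝓡}
    (h : Iso (X.sum (regular 𝓡)) (Y.sum (regular 𝓡))) : Iso X Y := by
  obtain ⟨φ, hφ⟩ := h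
  change (X.carrier × R) ≃ₗ[Rᵐᵒᵖ] (Y.carrier × R) at φ
  change ∀ γ (x : X.carrier × R),
    x ∈ (X.grading γ).prod (𝓡 γ) ↔ φ x ∈ (Y.grading γ).prod (𝓡 γ) at hφ
  have hφ' : ∀ γ (x : Y.carrier × R), x ∈ (Y.grading γ).prod (𝓡 γ) →
      φ.symm x ∈ (X.grading γ).prod (𝓡 γ) := fun γ x hx => by
    rwa [hφ, φ.apply_symm_apply]
  have h01 : φ (0, 1) ∈ (Y.grading 0).prod (𝓡 0) :=
    (hφ 0 _).1 ⟨zero_mem _, SetLike.one_mem_graded 𝓡⟩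
  have h01' : φ.symm (0, 1) ∈ (X.grading 0).prod (𝓡 0) :=
    hφ' 0 (0, 1) ⟨zero_mem _, SetLike.one_mem_graded 𝓡⟩
  set m := (φ.symm (0, 1)).1 with hm
  have hmem : φ (m, 0) ∈ (Y.grading 0).prod (𝓡 0) := (hφ 0 _).1 ⟨h01'.1, zero_mem _⟩
  have hφs : ∀ s : R, φ (0, s) = op s • φ (0, 1) := fun s => by
    rw [← map_smul]
    congr 1
    exact Prod.ext (smul_zero _).symm (one_mul s).symm
  have hsum : (φ (0, 1)).2 * (φ.symm (0, 1)).2 + (φ (m, 0)).2 = 1 := by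
    have h1 : φ (m, (φ.symm (0, 1)).2) = (0, 1) := φ.apply_symm_apply (0, 1)
    have : ((m, (φ.symm (0, 1)).2) : X.carrier × R) = (0, (φ.symm (0, 1)).2) + (m, 0) := by simp
    rw [this, map_add, hφs] at h1
    exact congrArg Prod.snd h1
  obtain ⟨y, hy, v, hv, huv, hvu⟩ := h𝓡 _ h01.2 _ h01'.2 _ hmem.2 hsum
  have hmy : op y • m ∈ X.grading 0 := by
    have := X.isGraded.smul_mem 0 0 m y h01'.1 hy
    rwa [zero_add] at this
  -- the shear `(x, s) ↦ (x + m y s, s)`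
  let L : (X.carrier × R) →ₗ[Rᵐᵒᵖ] X.carrier := mulElement (op y • m) ∘ₗ LinearMap.snd _ _ _
  have hL : ∀ γ (x : X.carrier × R), x ∈ (X.grading γ).prod (𝓡 γ) → L x ∈ X.grading γ := fun γ x hx => by
    have := X.isGraded.smul_mem 0 γ _ _ hmy hx.2
    rwa [zero_add] at this
  let sh : (X.carrier × R) ≃ₗ[Rᵐᵒᵖ] (X.carrier × R) := LinearEquiv.ofLinearMap
    (LinearMap.id + LinearMap.inl _ _ _ ∘ₗ L) (LinearMap.id - LinearMap.inl _ _ _ ∘ₗ L)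
    (LinearMap.ext fun x => Prod.ext (by simp [L]) (by simp [L]))
    (LinearMap.ext fun x => Prod.ext (by simp [L]) (by simp [L]))
  have hsh : ∀ x, sh x = x + (L x, 0) := fun x => rfl
  have hsh' : ∀ x, sh.symm x = x - (L x, 0) := fun x => rfl
  have hsh1 : (sh.trans φ) (0, 1) = φ (0, 1) + op y • φ (m, 0) := by
    rw [LinearEquiv.trans_apply, hsh, map_add, ← map_smul]
    congr 2
    exact Prod.ext (by exact one_smul Rᵐᵒᵖ (op y • m)) (by simp)
  refine iso_of_isUnit_component (sh.trans φ) (fun γ x hx => ?_) (fun γ x hx => ?_) hv ?_ ?_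
  · rw [LinearEquiv.trans_apply, hsh]
    exact (hφ γ _).1 (add_mem hx ⟨hL γ x hx, zero_mem _⟩)
  · change sh.symm (φ.symm x) ∈ _
    rw [hsh']
    exact sub_mem (hφ' γ x hx) ⟨hL γ _ (hφ' γ x hx), zero_mem _⟩
  · rw [hsh1]
    exact huv
  · rw [hsh1]
    exact hvu

/-- Cancellation passes to retracts. -/
theorem Iso.sum_of_retract {X Y T F : GrProj 𝓡} (i : T.carrier →ₗ[Rᵐᵒᵖ] F.carrier)
    (h : F.carrier →ₗ[Rᵐᵒᵖ] T.carrier) (hi : ∀ γ x, x ∈ T.grading γ → i x ∈ F.grading γ)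
    (hh : ∀ γ x, x ∈ F.grading γ → h x ∈ T.grading γ) (hhi : ∀ x, h (i x) = x)
    (hXY : Iso (X.sum T) (Y.sum T)) : Iso (X.sum F) (Y.sum F) := by
  obtain ⟨φ, hφ⟩ := hXY
  change (X.carrier × T.carrier) ≃ₗ[Rᵐᵒᵖ] (Y.carrier × T.carrier) at φ
  change ∀ γ (x : X.carrier × T.carrier), x ∈ (X.grading γ).prod (T.grading γ) ↔
    φ x ∈ (Y.grading γ).prod (T.grading γ) at hφ
  have hφ' : ∀ γ (x : Y.carrier × T.carrier), x ∈ (Y.grading γ).prod (T.grading γ) → φ.symm x ∈ (X.grading γ).prod (T.grading γ) := fun γ x hx => by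
    rwa [hφ, φ.apply_symm_apply]
  -- Since `F` splits as the image of `i` plus the kernel of `h`, a map on the summands involving
  -- `T` is extended by the identity on the kernel of `h`.
  let ext : ∀ {X Y : GrProj 𝓡}, ((X.carrier × T.carrier) →ₗ[Rᵐᵒᵖ] (Y.carrier × T.carrier)) →
      ((X.carrier × F.carrier) →ₗ[Rᵐᵒᵖ] (Y.carrier × F.carrier)) := fun f =>
    (LinearMap.prodMap LinearMap.id i) ∘ₗ f ∘ₗ (LinearMap.prodMap LinearMap.id h) +
      LinearMap.prodMap 0 (LinearMap.id - i ∘ₗ h)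
  have hext : ∀ {X Y : GrProj 𝓡} (f : (X.carrier × T.carrier) →ₗ[Rᵐᵒᵖ] (Y.carrier × T.carrier)) x,
      ext f x = ((f (x.1, h x.2)).1, i (f (x.1, h x.2)).2 + (x.2 - i (h x.2))) := fun f x =>
    Prod.ext (add_zero _) rfl
  have hmem : ∀ {X Y : GrProj 𝓡} (f : (X.carrier × T.carrier) →ₗ[Rᵐᵒᵖ] (Y.carrier × T.carrier)),
      (∀ γ (x : X.carrier × T.carrier), x ∈ (X.grading γ).prod (T.grading γ) → f x ∈ (Y.grading γ).prod (T.grading γ)) →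
      ∀ γ (x : X.carrier × F.carrier), x ∈ (X.grading γ).prod (F.grading γ) → ext f x ∈ (Y.grading γ).prod (F.grading γ) := by
    intro X Y f hf γ x hx
    rw [hext]
    have := hf γ (x.1, h x.2) ⟨hx.1, hh γ _ hx.2⟩
    have hx2 : x.2 ∈ F.grading γ := hx.2
    have h2 : i (f (x.1, h x.2)).2 + (x.2 - i (h x.2)) ∈ F.grading γ :=
      add_mem (hi γ _ this.2) (sub_mem hx2 (hi γ _ (hh γ _ hx2)))
    exact ⟨this.1, h2⟩
  have hcomp : ∀ {X Y : GrProj 𝓡} (f : (X.carrier × T.carrier) →ₗ[Rᵐᵒᵖ] (Y.carrier × T.carrier))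
      (g : (Y.carrier × T.carrier) →ₗ[Rᵐᵒᵖ] (X.carrier × T.carrier)), (∀ x, f (g x) = x) →
      ∀ x, ext f (ext g x) = x := by
    intro X Y f g hfg x
    rw [hext, hext]
    simp only [map_add, map_sub, hhi, sub_self, add_zero]
    rw [Prod.mk.eta, hfg]
    simp
  exact Iso.of_linearMap (P := X.sum F) (Q := Y.sum F) (ext φ.toLinearMap) (ext φ.symm.toLinearMap)
    (hmem (X := X) (Y := Y) _ fun γ x hx => (hφ γ x).1 hx) (hmem (X := Y) (Y := X) _ hφ')
    (hcomp (X := X) (Y := Y) _ _ φ.apply_symm_apply) (hcomp (X := Y) (Y := X) _ _ φ.symm_apply_apply)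

end GrProj

/-! ### Graded free covers and splittings -/

namespace GrProj

variable {Γ : Type uΓ} [AddCommGroup Γ] [DecidableEq Γ] {R : Type uR} [Ring R]
  {𝓡 : Γ → AddSubgroup R}

/-- Finitely many homogeneous elements are in the image of a graded map from a graded free
module. -/
theorem exists_free_of_homogeneous [GradedRing 𝓡] (T : GrProj 𝓡) (t : Finset T.carrier)
    (ht : ∀ x ∈ t, ∃ γ, x ∈ T.grading γ) :
    ∃ F : GrProj 𝓡, Vgr.mk F ∈ AddSubmonoid.closure
        (Set.range fun γ => Vgr.shift γ (Vgr.mk (regular 𝓡))) ∧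
      ∃ h : F.carrier →ₗ[Rᵐᵒᵖ] T.carrier, (∀ γ x, x ∈ F.grading γ → h x ∈ T.grading γ) ∧
        ∀ x ∈ t, x ∈ LinearMap.range h := by
  classical
  induction t using Finset.induction_on with
  | empty => exact ⟨zero 𝓡, zero_mem _, 0, fun _ _ _ => zero_mem _, by simp⟩
  | insert a s ha ih =>
    obtain ⟨F, hF, h, hh, hs⟩ := ih fun x hx => ht x (Finset.mem_insert_of_mem hx)
    obtain ⟨γ, hγ⟩ := ht a (Finset.mem_insert_self a s)
    let h' : (R × F.carrier) →ₗ[Rᵐᵒᵖ] T.carrier := (mulElement a).coprod h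
    -- The shift by `-γ` puts the element `1` in degree `γ`, so that `1 ↦ a` is a graded map.
    refine ⟨((regular 𝓡).shift (-γ)).sum F, AddSubmonoid.add_mem _
      (AddSubmonoid.subset_closure (Set.mem_range_self (-γ))) hF, h',
      fun l x hx => ?_, fun x hx => ?_⟩
    · obtain ⟨x, y⟩ := x
      obtain ⟨h1, h2⟩ := hx
      change R at x
      change op x • a + h y ∈ T.grading l
      have h3 := T.isGraded.smul_mem γ (-γ + l) a x hγ h1
      rw [add_neg_cancel_left] at h3
      exact add_mem h3 (hh l y h2)
    · rcases Finset.mem_insert.1 hx with rfl | hx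
      · refine ⟨((1 : R), 0), ?_⟩
        change op (1 : R) • x + h 0 = x
        simp
      · obtain ⟨y, rfl⟩ := hs x hx
        refine ⟨((0 : R), y), ?_⟩
        change op (0 : R) • a + h y = h y
        simp

theorem exists_homogeneous_generators (T : GrProj 𝓡) :
    ∃ t : Finset T.carrier, (∀ x ∈ t, ∃ γ, x ∈ T.grading γ) ∧
      Submodule.span Rᵐᵒᵖ (t : Set T.carrier) = ⊤ := by
  classical
  obtain ⟨s, hs⟩ := T.finite.fg_top
  let := T.isGraded.isInternal.chooseDecomposition
  refine ⟨s.biUnion fun x => (decompose T.grading x).support.image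
    fun γ => (decompose T.grading x γ : T.carrier), fun x hx => ?_, ?_⟩
  · simp only [Finset.mem_biUnion, Finset.mem_image] at hx
    obtain ⟨y, -, γ, -, rfl⟩ := hx
    exact ⟨γ, SetLike.coe_mem _⟩
  · rw [eq_top_iff, ← hs, Submodule.span_le]
    intro x hx
    rw [SetLike.mem_coe, ← sum_support_decompose T.grading x]
    refine Submodule.sum_mem _ fun γ hγ => Submodule.subset_span ?_
    simp only [Finset.coe_biUnion, Set.mem_iUnion, Finset.coe_image]
    exact ⟨x, hx, γ, hγ, rfl⟩

/-- Every graded finitely generated projective module is a retract of a graded free module. -/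
theorem exists_free_retract [GradedRing 𝓡] (T : GrProj 𝓡) :
    ∃ F : GrProj 𝓡, Vgr.mk F ∈ AddSubmonoid.closure
        (Set.range fun γ => Vgr.shift γ (Vgr.mk (regular 𝓡))) ∧
      ∃ (i : T.carrier →ₗ[Rᵐᵒᵖ] F.carrier) (h : F.carrier →ₗ[Rᵐᵒᵖ] T.carrier),
        (∀ γ x, x ∈ T.grading γ → i x ∈ F.grading γ) ∧
        (∀ γ x, x ∈ F.grading γ → h x ∈ T.grading γ) ∧ ∀ x, h (i x) = x := by
  obtain ⟨t, ht, hspan⟩ := T.exists_homogeneous_generators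
  obtain ⟨F, hF, h, hh, hth⟩ := T.exists_free_of_homogeneous t ht
  have hsurj : Function.Surjective h := by
    rw [← LinearMap.range_eq_top, eq_top_iff, ← hspan, Submodule.span_le]
    exact hth
  obtain ⟨i, hi⟩ := Module.projective_lifting_property h LinearMap.id hsurj
  let := T.isGraded.isInternal.chooseDecomposition
  let := F.isGraded.isInternal.chooseDecomposition
  -- Projectivity gives a section that need not respect degrees; its degree-zero component does, and
  -- is still a section because `h` is graded.
  obtain ⟨i₀, hi₀⟩ := exists_degreeZeroPart T.isGraded F.isGraded i
  refine ⟨F, hF, i₀, h, fun γ x hx => ?_, hh, fun x => ?_⟩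
  · rw [hi₀ γ x hx]
    exact SetLike.coe_mem _
  · induction x using Decomposition.inductionOn T.grading with
    | zero => simp
    | @homogeneous γ m =>
      rw [hi₀ γ m m.2]
      refine (decompose_map_of_graded h.toAddMonoidHom hh γ (i m)).symm.trans ?_
      have : h.toAddMonoidHom (i m) = m := LinearMap.congr_fun hi (m : T.carrier)
      rw [this, decompose_of_mem_same _ m.2]
    | add m m' hm hm' => rw [map_add, map_add, hm, hm']

end GrProj

/-! ### Cancellation in the class monoid -/

namespace Vgr

variable {Γ : Type uΓ} [AddCommGroup Γ] [DecidableEq Γ] {R : Type uR} [Ring R]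
  {𝓡 : Γ → AddSubgroup R}

theorem shift_injective (α : Γ) : Function.Injective (shift (𝓡 := 𝓡) α) := fun x y h => by
  rw [← shift_zero x, ← shift_zero y, ← neg_add_cancel α, shift_add, shift_add, h]

/-- The cancelled module is enlarged to a graded free module of which it is a retract. This is
removed one shifted copy of `R` at a time, each shift being undone by shifting the other summands in
the opposite direction. -/
theorem add_right_cancel_of_stableRangeOne [GradedRing 𝓡] (h𝓡 : DegreeZeroStableRangeOne 𝓡)
    {x y z : Vgr 𝓡} (h : x + z = y + z) : x = y := by
  obtain ⟨X⟩ := x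
  obtain ⟨Y⟩ := y
  obtain ⟨T⟩ := z
  obtain ⟨F, hF, i, p, hi, hp, hpi⟩ := T.exists_free_retract
  have hXY : mk X + mk F = mk Y + mk F :=
    mk_eq_mk.2 (GrProj.Iso.sum_of_retract i p hi hp hpi (mk_eq_mk.1 h))
  change mk X = mk Y
  generalize mk F = c at hF hXY
  generalize mk X = x at *
  generalize mk Y = y at *
  clear h
  induction hF using AddSubmonoid.closure_induction generalizing x y with
  | mem c hc =>
    obtain ⟨γ, rfl⟩ := hc
    have h1 : ∀ w : Vgr 𝓡, w + shift γ (mk (GrProj.regular 𝓡)) =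
        shift γ (shift (-γ) w + mk (GrProj.regular 𝓡)) := fun w => by
      rw [map_add, ← shift_add, add_neg_cancel, shift_zero]
    simp only [h1] at hXY
    have h2 := shift_injective γ hXY
    refine shift_injective (-γ) ?_
    generalize shift (-γ) x = x at *
    generalize shift (-γ) y = y at *
    obtain ⟨X⟩ := x
    obtain ⟨Y⟩ := y
    exact mk_eq_mk.2 ((mk_eq_mk.1 h2).of_sum_regular h𝓡)
  | zero => simpa using hXY
  | add c d _ _ hc hd =>
    rw [← add_assoc, ← add_assoc] at hXY
    exact hc _ _ (hd _ _ hXY)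

end Vgr

/-! ### The class monoid inside its group completion -/

namespace K0gr

variable {Γ : Type uΓ} [AddCommGroup Γ] [DecidableEq Γ] {R : Type uR} [Ring R]
  {𝓡 : Γ → AddSubgroup R}

theorem of_injective [GradedRing 𝓡] (h𝓡 : DegreeZeroStableRangeOne 𝓡) :
    Function.Injective (of 𝓡) := fun x y h => by
  have : IsRightCancelAdd (Vgr 𝓡) := ⟨fun _ _ _ h => Vgr.add_right_cancel_of_stableRangeOne h𝓡 h⟩
  have : IsCancelAdd (Vgr 𝓡) := AddCommMagma.IsRightCancelAdd.toIsCancelAdd _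
  exact Algebra.GrothendieckAddGroup.of_injective h

theorem exists_of_sub_of (x : K0gr 𝓡) : ∃ a b, x = of 𝓡 a - of 𝓡 b := by
  induction x using AddLocalization.ind with
  | H y =>
    obtain ⟨a, b⟩ := y
    refine ⟨a, b, ?_⟩
    refine (Eq.trans ?_ (Algebra.GrothendieckAddGroup.mk_sub_mk _ _ _ _).symm)
    simp
    rfl

theorem single_smul (α : Γ) (x : Vgr 𝓡) :
    (AddMonoidAlgebra.single α 1 : AddMonoidAlgebra ℤ Γ) • of 𝓡 x = of 𝓡 (Vgr.shift α x) := by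
  obtain ⟨P⟩ := x
  exact single_smul_of 𝓡 α P

end K0gr

/-! ### Isomorphisms of Grothendieck groups and of monoids of classes -/

section

variable {Γ : Type uΓ} [AddCommGroup Γ] [DecidableEq Γ] {R : Type uR} [Ring R]
  {𝓡 : Γ → AddSubgroup R} {S : Type uS} [Ring S] {𝓢 : Γ → AddSubgroup S}

theorem K0gr.exists_linearEquiv_of_addEquiv [GradedRing 𝓡] [GradedRing 𝓢] (g : Vgr 𝓡 ≃+ Vgr 𝓢)
    (hg : ∀ γ x, g (Vgr.shift γ x) = Vgr.shift γ (g x))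
    (h1 : g (Vgr.mk (GrProj.regular 𝓡)) = Vgr.mk (GrProj.regular 𝓢)) :
    ∃ f : K0gr 𝓡 ≃ₗ[AddMonoidAlgebra ℤ Γ] K0gr 𝓢,
      (∀ x, f x ∈ K0gr.positiveCone 𝓢 ↔ x ∈ K0gr.positiveCone 𝓡) ∧
        f (K0gr.unitClass 𝓡) = K0gr.unitClass 𝓢 := by
  let F : K0gr 𝓡 →+ K0gr 𝓢 := Algebra.GrothendieckAddGroup.lift ((K0gr.of 𝓢).comp g.toAddMonoidHom)
  let G : K0gr 𝓢 →+ K0gr 𝓡 :=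
    Algebra.GrothendieckAddGroup.lift ((K0gr.of 𝓡).comp g.symm.toAddMonoidHom)
  have hF : ∀ x, F (K0gr.of 𝓡 x) = K0gr.of 𝓢 (g x) := K0gr.lift_of 𝓡 _
  have hG : ∀ x, G (K0gr.of 𝓢 x) = K0gr.of 𝓡 (g.symm x) := K0gr.lift_of 𝓢 _
  have hGF : ∀ x, G (F x) = x := fun x => by
    obtain ⟨a, b, rfl⟩ := K0gr.exists_of_sub_of x
    simp [hF, hG]
  have hFG : ∀ x, F (G x) = x := fun x => by
    obtain ⟨a, b, rfl⟩ := K0gr.exists_of_sub_of x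
    simp [hF, hG]
  have hsmul : ∀ (r : AddMonoidAlgebra ℤ Γ) x, F (r • x) = r • F x := by
    intro r x
    induction r using AddMonoidAlgebra.induction_linear with
    | zero => simp
    | add r s hr hs => rw [add_smul, add_smul, map_add, hr, hs]
    | single γ n =>
      have : (AddMonoidAlgebra.single γ n : AddMonoidAlgebra ℤ Γ) =
          n • AddMonoidAlgebra.single γ 1 := by simp
      rw [this, smul_assoc, smul_assoc, map_zsmul]
      congr 1
      obtain ⟨a, b, rfl⟩ := K0gr.exists_of_sub_of x
      simp only [smul_sub, map_sub, K0gr.single_smul, hF, hg]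
  refine ⟨{ F with map_smul' := hsmul, invFun := G, left_inv := hGF, right_inv := hFG }, ?_, ?_⟩
  · intro x
    change F x ∈ _ ↔ _
    constructor
    · rintro ⟨y, hy⟩
      exact ⟨g.symm y, by rw [← hG, hy, hGF]⟩
    · rintro ⟨y, rfl⟩
      exact ⟨g y, (hF y).symm⟩
  · exact (hF _).trans (congrArg _ h1)

/-- By cancellation the class monoid is identified with the positive cone, so an isomorphism
preserving the cones restricts to the monoids. -/
theorem K0gr.exists_addEquiv_of_linearEquiv [GradedRing 𝓡] [GradedRing 𝓢]
    (h𝓡 : DegreeZeroStableRangeOne 𝓡) (h𝓢 : DegreeZeroStableRangeOne 𝓢)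
    (f : K0gr 𝓡 ≃ₗ[AddMonoidAlgebra ℤ Γ] K0gr 𝓢)
    (hf : ∀ x, f x ∈ K0gr.positiveCone 𝓢 ↔ x ∈ K0gr.positiveCone 𝓡)
    (h1 : f (K0gr.unitClass 𝓡) = K0gr.unitClass 𝓢) :
    ∃ g : Vgr 𝓡 ≃+ Vgr 𝓢, (∀ γ x, g (Vgr.shift γ x) = Vgr.shift γ (g x)) ∧
      g (Vgr.mk (GrProj.regular 𝓡)) = Vgr.mk (GrProj.regular 𝓢) := by
  have hR := K0gr.of_injective h𝓡
  have hS := K0gr.of_injective h𝓢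
  have h : ∀ x, ∃ y, K0gr.of 𝓢 y = f (K0gr.of 𝓡 x) := fun x => (hf _).2 ⟨x, rfl⟩
  have h' : ∀ y, ∃ x, K0gr.of 𝓡 x = f.symm (K0gr.of 𝓢 y) := fun y =>
    (hf _).1 (by rw [f.apply_symm_apply]; exact ⟨y, rfl⟩)
  choose g hg using h
  choose g' hg' using h'
  refine ⟨{ toFun := g, invFun := g', left_inv := fun x => hR ?_, right_inv := fun y => hS ?_,
            map_add' := fun x y => hS ?_ }, fun γ x => hS ?_, hS ?_⟩
  · rw [hg', hg, f.symm_apply_apply]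
  · rw [hg, hg', f.apply_symm_apply]
  · rw [map_add, hg, hg, hg, map_add, map_add]
  · change K0gr.of 𝓢 (g _) = K0gr.of 𝓢 (Vgr.shift γ (g x))
    rw [hg, ← K0gr.single_smul, ← K0gr.single_smul, map_smul, hg]
  · exact (hg _).trans h1

/-! ### Transport of graded modules along an isomorphism of graded rings -/

/-- `Q` is obtained from `P` by transport along the isomorphism `e`. -/
def GrProj.Transport (e : R ≃+* S) (P : GrProj 𝓡) (Q : GrProj 𝓢) : Prop :=
  ∃ h : P.carrier ≃+ Q.carrier, (∀ r x, h (op r • x) = op (e r) • h x) ∧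
    ∀ γ x, x ∈ P.grading γ ↔ h x ∈ Q.grading γ

namespace GrProj.Transport

variable {e : R ≃+* S}

theorem symm {P : GrProj 𝓡} {Q : GrProj 𝓢} (h : Transport e P Q) : Transport e.symm Q P := by
  obtain ⟨h, hh, hg⟩ := h
  refine ⟨h.symm, fun r x => h.injective ?_, fun γ x => ?_⟩
  · rw [hh, e.apply_symm_apply, h.apply_symm_apply, h.apply_symm_apply]
  · rw [hg, h.apply_symm_apply]

theorem iso {P P' : GrProj 𝓡} {Q Q' : GrProj 𝓢} (h : Transport e P Q) (h' : Transport e P' Q')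
    (hP : Iso P P') : Iso Q Q' := by
  obtain ⟨h, hh, hg⟩ := h
  obtain ⟨h', hh', hg'⟩ := h'
  obtain ⟨k, hk⟩ := hP
  refine ⟨{ (h.symm.trans k.toAddEquiv).trans h' with map_smul' := fun r x => ?_ }, fun γ x => ?_⟩
  · change h' (k (h.symm (r • x))) = r • h' (k (h.symm x))
    have : h.symm (r • x) = op (e.symm (unop r)) • h.symm x := h.injective (by simp [hh])
    rw [this, map_smul, hh', e.apply_symm_apply, op_unop]
  · change _ ↔ h' (k (h.symm x)) ∈ _
    rw [← hg', ← hk, hg, h.apply_symm_apply]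

theorem sum {P P' : GrProj 𝓡} {Q Q' : GrProj 𝓢} (h : Transport e P Q) (h' : Transport e P' Q') :
    Transport e (P.sum P') (Q.sum Q') := by
  obtain ⟨h, hh, hg⟩ := h
  obtain ⟨h', hh', hg'⟩ := h'
  exact ⟨h.prodCongr h', fun r x => Prod.ext (hh r x.1) (hh' r x.2),
    fun γ x => and_congr (hg γ x.1) (hg' γ x.2)⟩

theorem shift {P : GrProj 𝓡} {Q : GrProj 𝓢} (h : Transport e P Q) (α : Γ) :
    Transport e (P.shift α) (Q.shift α) := by
  obtain ⟨h, hh, hg⟩ := h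
  exact ⟨h, hh, fun γ => hg (α + γ)⟩

theorem regular [GradedRing 𝓡] [GradedRing 𝓢] (he : ∀ γ x, x ∈ 𝓡 γ ↔ e x ∈ 𝓢 γ) :
    Transport e (GrProj.regular 𝓡) (GrProj.regular 𝓢) :=
  ⟨e.toAddEquiv, fun r (x : R) => map_mul e x r, he⟩

/-- The same abelian group serves for `Q`, with scalars acting through the inverse of `e`. The rings
may live in different universes, so the carrier is shrunk; this is possible because a finitely
generated module is a quotient of a finite power of the ring. -/
theorem exists_transport (he : ∀ γ x, x ∈ 𝓡 γ ↔ e x ∈ 𝓢 γ) (P : GrProj 𝓡) :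
    ∃ Q : GrProj 𝓢, Transport e P Q := by
  have : Small.{uS} P.carrier := by
    obtain ⟨n, f, hf⟩ := Module.Finite.exists_fin' Rᵐᵒᵖ P.carrier
    have : Small.{uS} R := ⟨S, ⟨e.toEquiv⟩⟩
    have : Small.{uS} Rᵐᵒᵖ := small_map opEquiv.symm
    exact small_of_surjective hf
  let ε : Rᵐᵒᵖ ≃+* Sᵐᵒᵖ := RingEquiv.op e
  let : Module Sᵐᵒᵖ P.carrier := Module.compHom P.carrier ε.symm.toRingHom
  have hsm : ∀ (s : Sᵐᵒᵖ) (x : P.carrier), s • x = ε.symm s • x := fun _ _ => rfl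
  let K : Shrink.{uS} P.carrier ≃ₗ[Sᵐᵒᵖ] P.carrier := Shrink.linearEquiv Sᵐᵒᵖ P.carrier
  have := RingHomInvPair.of_ringEquiv ε
  have := RingHomInvPair.symm (ε : Rᵐᵒᵖ →+* Sᵐᵒᵖ) (ε.symm : Sᵐᵒᵖ →+* Rᵐᵒᵖ)
  let I : P.carrier ≃ₛₗ[(ε : Rᵐᵒᵖ →+* Sᵐᵒᵖ)] P.carrier :=
    { AddEquiv.refl P.carrier with
      map_smul' := fun r x => by
        change r • x = ε.symm (ε r) • x
        rw [ε.symm_apply_apply] }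
  have hfin : Module.Finite Sᵐᵒᵖ P.carrier := Module.Finite.of_surjective I.toLinearMap I.surjective
  have hproj : Module.Projective Sᵐᵒᵖ P.carrier := Module.Projective.of_equiv I
  let Q : GrProj 𝓢 :=
    { carrier := Shrink.{uS} P.carrier
      grading := fun γ => (P.grading γ).comap K.toAddEquiv.toAddMonoidHom
      isGraded := ⟨isInternal_comap_of_retract P.isGraded.isInternal K.toAddEquiv.toAddMonoidHom
        K.symm.toAddEquiv.toAddMonoidHom K.symm_apply_apply fun γ x hx => by
          change K (K.symm x) ∈ P.grading γ
          rwa [K.apply_symm_apply],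
        fun l γ m r hm hr => by
          change K (op r • m) ∈ P.grading (l + γ)
          rw [map_smul, hsm]
          exact P.isGraded.smul_mem l γ _ _ hm ((he _ _).2 (by simpa using hr))⟩
      finite := Module.Finite.equiv K.symm
      projective := Module.Projective.of_equiv K.symm }
  refine ⟨Q, K.symm.toAddEquiv, fun r x => ?_, fun γ x => ?_⟩
  · change K.symm (op r • x) = op (e r) • K.symm x
    rw [← map_smul, hsm]
    simp [ε]
  · change _ ↔ K (K.symm x) ∈ P.grading γ
    rw [K.apply_symm_apply]

end GrProj.Transport

theorem Vgr.exists_addEquiv_of_ringEquiv [GradedRing 𝓡] [GradedRing 𝓢] (e : R ≃+* S)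
    (he : ∀ γ x, x ∈ 𝓡 γ ↔ e x ∈ 𝓢 γ) :
    ∃ g : Vgr 𝓡 ≃+ Vgr 𝓢, (∀ γ x, g (Vgr.shift γ x) = Vgr.shift γ (g x)) ∧
      g (Vgr.mk (GrProj.regular 𝓡)) = Vgr.mk (GrProj.regular 𝓢) := by
  have he' : ∀ γ x, x ∈ 𝓢 γ ↔ e.symm x ∈ 𝓡 γ := fun γ x => by rw [he, e.apply_symm_apply]
  choose T hT using GrProj.Transport.exists_transport he
  choose T' hT' using GrProj.Transport.exists_transport he'
  let g : Vgr 𝓡 → Vgr 𝓢 := Quotient.map T fun P P' h => (hT P).iso (hT P') h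
  let g' : Vgr 𝓢 → Vgr 𝓡 := Quotient.map T' fun P P' h => (hT' P).iso (hT' P') h
  have hg : ∀ {P Q}, GrProj.Transport e P Q → g (mk P) = mk Q := fun {P Q} h =>
    mk_eq_mk.2 ((hT P).iso h (GrProj.Iso.refl P))
  have hg' : ∀ {P Q}, GrProj.Transport e.symm P Q → g' (mk P) = mk Q := fun {P Q} h =>
    mk_eq_mk.2 ((hT' P).iso h (GrProj.Iso.refl P))
  refine ⟨{ toFun := g, invFun := g', left_inv := ?_, right_inv := ?_, map_add' := ?_ }, ?_,
    hg (GrProj.Transport.regular he)⟩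
  · rintro ⟨P⟩
    exact (congrArg g' (hg (hT P))).trans (hg' (hT P).symm)
  · rintro ⟨P⟩
    exact (congrArg g (hg' (hT' P))).trans (hg (hT' P).symm)
  · rintro ⟨P⟩ ⟨Q⟩
    exact hg ((hT P).sum (hT Q))
  · rintro γ ⟨P⟩
    exact hg ((hT P).shift γ)

end

/-! ### Matrix units in graded matricial algebras -/

section MatrixUnits

variable {A : Type uA} [CommRing A] {l : ℕ} {n : Fin l → ℕ}

/-- The element of `∏ 𝕄_{n_i}(A)` with the only nonzero entry `a`, in the position `(j, k)` of the
`i`-th block. -/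
def blockUnit (i : Fin l) (j k : Fin (n i)) (a : A) : ∀ i, Matrix (Fin (n i)) (Fin (n i)) A :=
  Pi.single i (Matrix.single j k a)

theorem blockUnit_mul (i : Fin l) (j k m : Fin (n i)) (a b : A) :
    blockUnit i j k a * blockUnit i k m b = blockUnit i j m (a * b) := by
  rw [blockUnit, blockUnit, ← Pi.single_mul, Matrix.single_mul_single_same, blockUnit]

theorem blockUnit_mul_of_ne {i i' : Fin l} {k : Fin (n i)} {k' : Fin (n i')}
    (h : (⟨i, k⟩ : Σ i, Fin (n i)) ≠ ⟨i', k'⟩) (j : Fin (n i)) (m : Fin (n i')) (a b : A) :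
    blockUnit i j k a * blockUnit i' k' m b = 0 := by
  by_cases hi : i = i'
  · subst hi
    rw [blockUnit, blockUnit, ← Pi.single_mul,
      Matrix.single_mul_single_of_ne _ _ _ _ (fun hk => h (by rw [hk])), Pi.single_zero]
  · funext i''
    by_cases h1 : i'' = i
    · subst h1
      simp [blockUnit, Pi.single_eq_of_ne hi]
    · simp [blockUnit, Pi.single_eq_of_ne h1]

theorem smul_blockUnit (i : Fin l) (j k : Fin (n i)) (a b : A) :
    a • blockUnit i j k b = blockUnit i j k (a * b) := by
  rw [blockUnit, ← Pi.single_smul, Matrix.smul_single]; rfl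

theorem sum_blockUnit_diag :
    ∑ t : Σ i, Fin (n i), blockUnit t.1 t.2 t.2 (1 : A) = 1 := by
  rw [Fintype.sum_sigma]
  funext i
  rw [Finset.sum_apply, Finset.sum_eq_single i]
  · simp only [blockUnit, Finset.sum_apply, Pi.single_eq_same]
    exact Matrix.sum_single_one
  · intro i' _ hi
    simp [blockUnit, Pi.single_eq_of_ne hi.symm]
  · simp

theorem blockUnit_mul_mul (x : ∀ i, Matrix (Fin (n i)) (Fin (n i)) A) (i : Fin l)
    (j j' k k' : Fin (n i)) (a b : A) :
    blockUnit i j j' a * x * blockUnit i k k' b = blockUnit i j k' (a * x i j' k * b) := by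
  funext i'
  by_cases h1 : i' = i
  · subst h1
    simp only [blockUnit, Pi.mul_apply, Pi.single_eq_same]
    exact Matrix.single_mul_mul_single _ _ _ _ _ _ _
  · simp [blockUnit, Pi.single_eq_of_ne h1]

/-- Linear maps that agree on the matrix units are equal. -/
theorem eq_of_forall_blockUnit {M : Type*} [AddCommGroup M] [Module A M]
    {f g : (∀ i, Matrix (Fin (n i)) (Fin (n i)) A) →ₗ[A] M}
    (h : ∀ i j k, f (blockUnit i j k 1) = g (blockUnit i j k 1)) : f = g := by
  refine LinearMap.pi_ext fun i x => ?_
  induction x using Matrix.induction_on' with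
  | h_zero => simp
  | h_add p q hp hq => rw [Pi.single_add, map_add, map_add, hp, hq]
  | h_std_basis j k a =>
    have : (Pi.single i (Matrix.single j k a) : ∀ i, Matrix (Fin (n i)) (Fin (n i)) A) =
        a • blockUnit i j k 1 := by rw [smul_blockUnit, mul_one]; rfl
    rw [this, map_smul, map_smul, h]

theorem blockUnit_mem {Γ : Type uΓ} [AddCommGroup Γ] {𝒜 : Γ → AddSubgroup A}
    {δ : ∀ i, Fin (n i) → Γ} {i : Fin l} {j k : Fin (n i)} {a : A} {γ : Γ}
    (ha : a ∈ 𝒜 (γ + δ i k - δ i j)) : blockUnit i j k a ∈ matricialGrading 𝒜 δ γ := by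
  intro i' j' k'
  by_cases h1 : i' = i
  · subst h1
    simp only [blockUnit, Pi.single_eq_same, Matrix.single_apply]
    split_ifs with h
    · rw [← h.1, ← h.2]
      exact ha
    · exact zero_mem _
  · simp [blockUnit, Pi.single_eq_of_ne h1]

end MatrixUnits

/-! ### The degree-zero part of a graded matricial algebra -/

section Graded

variable {Γ : Type uΓ} [AddCommGroup Γ] [DecidableEq Γ] {A : Type uA} [CommRing A]
  {𝒜 : Γ → AddSubgroup A} [GradedRing 𝒜] {l : ℕ} {n : Fin l → ℕ} {δ : ∀ i, Fin (n i) → Γ}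

theorem IsGradedField.exists_inv (hA : IsGradedField 𝒜) {γ : Γ} {a : A} (ha : a ∈ 𝒜 γ)
    (h0 : a ≠ 0) : ∃ b ∈ 𝒜 (-γ), a * b = 1 := by
  obtain ⟨u, rfl⟩ := hA.isUnit_of_mem γ a ha h0
  -- Only the component of degree `-γ` of the inverse contributes to the degree-zero part of the
  -- product with `a`.
  refine ⟨decompose 𝒜 (↑u⁻¹ : A) (-γ), SetLike.coe_mem _, ?_⟩
  rw [← coe_decompose_mul_add_of_left_mem 𝒜 ha, add_neg_cancel, Units.mul_inv,
    decompose_of_mem_same 𝒜 (SetLike.one_mem_graded 𝒜)]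

theorem matricialGrading_one_mem : 1 ∈ matricialGrading 𝒜 δ 0 := by
  rw [← sum_blockUnit_diag]
  refine sum_mem fun t _ => blockUnit_mem ?_
  rw [zero_add, sub_self]
  exact SetLike.one_mem_graded 𝒜

theorem matricialGrading_mul_mem {γ γ' : Γ} {x y : ∀ i, Matrix (Fin (n i)) (Fin (n i)) A}
    (hx : x ∈ matricialGrading 𝒜 δ γ) (hy : y ∈ matricialGrading 𝒜 δ γ') :
    x * y ∈ matricialGrading 𝒜 δ (γ + γ') := by
  intro i j k
  rw [Pi.mul_apply, Matrix.mul_apply]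
  refine sum_mem fun m _ => ?_
  have h : γ + γ' + δ i k - δ i j = (γ + δ i m - δ i j) + (γ' + δ i k - δ i m) := by abel
  rw [h]
  exact SetLike.mul_mem_graded (hx i j m) (hy i m k)

/-- The ring of homogeneous elements of degree zero of a graded matricial algebra. -/
def matricialDegreeZero (𝒜 : Γ → AddSubgroup A) [GradedRing 𝒜] (δ : ∀ i, Fin (n i) → Γ) :
    Subring (∀ i, Matrix (Fin (n i)) (Fin (n i)) A) :=
  { matricialGrading 𝒜 δ 0 with
    one_mem' := matricialGrading_one_mem
    mul_mem' := fun hx hy => by simpa using matricialGrading_mul_mem hx hy }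

/-- The corner of the degree-zero part at a diagonal matrix unit is a copy of `𝒜 0`, because the
shifts cancel on the diagonal, and `𝒜 0` is a field. -/
theorem hasStableRangeOne_matricialDegreeZero (hA : IsGradedField 𝒜) :
    HasStableRangeOne (matricialDegreeZero 𝒜 δ) := by
  have h1 : ∀ (i : Fin l) (j : Fin (n i)) (a : A), a ∈ 𝒜 0 →
      blockUnit i j j a ∈ matricialDegreeZero 𝒜 δ := fun i j a ha =>
    blockUnit_mem (by rwa [zero_add, sub_self])
  refine hasStableRangeOne_of_division_corners (ι := Σ i, Fin (n i))
    (fun t => ⟨blockUnit t.1 t.2 t.2 1, h1 _ _ _ (SetLike.one_mem_graded 𝒜)⟩) (fun t => ?_)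
    (fun t t' ht => ?_) ?_ fun t d hd => ?_
  · exact Subtype.ext (by simp [blockUnit_mul])
  · exact Subtype.ext (blockUnit_mul_of_ne ht _ _ _ _)
  · exact Subtype.ext (by simpa using sum_blockUnit_diag)
  · obtain ⟨d, hd0⟩ := d
    have hdm : d t.1 t.2 t.2 ∈ 𝒜 0 := by simpa using hd0 t.1 t.2 t.2
    have hne : d t.1 t.2 t.2 ≠ 0 := fun h => hd (Subtype.ext (by
      change blockUnit t.1 t.2 t.2 1 * d * blockUnit t.1 t.2 t.2 1 = 0
      rw [blockUnit_mul_mul, h]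
      simp [blockUnit]))
    obtain ⟨b, hb, hab⟩ := hA.exists_inv hdm hne
    rw [neg_zero] at hb
    refine ⟨⟨_, h1 t.1 t.2 b hb⟩, Subtype.ext ?_, Subtype.ext ?_, Subtype.ext ?_, Subtype.ext ?_⟩
    · change blockUnit t.1 t.2 t.2 1 * d * blockUnit t.1 t.2 t.2 1 * blockUnit t.1 t.2 t.2 b = _
      rw [blockUnit_mul_mul, blockUnit_mul, one_mul, mul_one, hab]
    · change blockUnit t.1 t.2 t.2 b * (blockUnit t.1 t.2 t.2 1 * d * blockUnit t.1 t.2 t.2 1) = _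
      rw [blockUnit_mul_mul, blockUnit_mul, one_mul, mul_one, mul_comm, hab]
    · change blockUnit t.1 t.2 t.2 1 * blockUnit t.1 t.2 t.2 b = blockUnit t.1 t.2 t.2 b
      rw [blockUnit_mul, one_mul]
    · change blockUnit t.1 t.2 t.2 b * blockUnit t.1 t.2 t.2 1 = blockUnit t.1 t.2 t.2 b
      rw [blockUnit_mul, mul_one]

/-- The condition involves finitely many elements, which lie in a common matricial stage; that stage
has the same identity, so a unit found there is a unit of `R`. -/
theorem IsGradedUltramatricial.degreeZeroStableRangeOne (hA : IsGradedField 𝒜) {R : Type uR}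
    [Ring R] [Algebra A R] {𝓡 : Γ → AddSubgroup R} [GradedRing 𝓡]
    (hR : IsGradedUltramatricial 𝒜 𝓡) : DegreeZeroStableRangeOne 𝓡 := by
  obtain ⟨T, hT, -, hmat, hex⟩ := hR.exists_chain
  intro a ha x hx b hb hab
  obtain ⟨i, hi⟩ := hex a
  obtain ⟨j, hj⟩ := hex x
  obtain ⟨k, hk⟩ := hex b
  have hai := hT (le_max_left i (max j k)) hi
  have hxi := hT ((le_max_left j k).trans (le_max_right i (max j k))) hj
  have hbi := hT ((le_max_right j k).trans (le_max_right i (max j k))) hk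
  obtain ⟨l, n, δ, e, he⟩ := hmat (max i (max j k))
  generalize T (max i (max j k)) = U at *
  have hmem : ∀ y : U, (y : R) ∈ 𝓡 0 → e.symm y ∈ matricialDegreeZero 𝒜 δ := fun y hy =>
    (he 0 _).2 (by rw [e.apply_symm_apply]; exact hy)
  have hmem' : ∀ y : matricialDegreeZero 𝒜 δ, (e y : R) ∈ 𝓡 0 := fun y => (he 0 y).1 y.2
  obtain ⟨y, ⟨u, hu⟩⟩ := hasStableRangeOne_matricialDegreeZero hA (δ := δ)
    ⟨_, hmem ⟨a, hai⟩ ha⟩ ⟨_, hmem ⟨x, hxi⟩ hx⟩ ⟨_, hmem ⟨b, hbi⟩ hb⟩ 1 (Subtype.ext (by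
      change e.symm ⟨a, hai⟩ * e.symm ⟨x, hxi⟩ + e.symm ⟨b, hbi⟩ * 1 = 1
      rw [mul_one, ← map_mul, ← map_add]
      exact (congrArg e.symm (Subtype.ext hab)).trans (map_one _)))
  have key : (e u : R) = a + b * e y := by
    rw [hu]
    change ((e (e.symm ⟨a, hai⟩ + e.symm ⟨b, hbi⟩ * y) : U) : R) = _
    rw [map_add, map_mul, e.apply_symm_apply, e.apply_symm_apply]
    rfl
  refine ⟨e y, hmem' y, e (↑u⁻¹ : matricialDegreeZero 𝒜 δ), hmem' _, ?_, ?_⟩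
  · rw [← key, ← MulMemClass.coe_mul, ← map_mul, ← MulMemClass.coe_mul, u.mul_inv]
    simp
  · rw [← key, ← MulMemClass.coe_mul, ← map_mul, ← MulMemClass.coe_mul, u.inv_mul]
    simp

end Graded

/-! ### Graded homomorphisms from matricial algebras -/

theorem Vgr.IsClass.of_equiv {Γ : Type uΓ} [AddCommGroup Γ] [DecidableEq Γ] {R : Type uR} [Ring R]
    {𝓡 : Γ → AddSubgroup R} [GradedRing 𝓡] {x : Vgr 𝓡} {e e' u v : R} (hx : x.IsClass e')
    (hu : u ∈ 𝓡 0) (hv : v ∈ 𝓡 0) (h1 : u * e' = u) (h2 : e * u = u) (h3 : v * e = v)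
    (h4 : e' * v = v) (h5 : u * v = e) (h6 : v * u = e') : x.IsClass e := by
  rw [← shift_zero x]
  exact (hx.shift_iff 0 e).2 ⟨u, by rwa [neg_zero], v, hv, h1, h2, h3, h4, h5, h6⟩

theorem Vgr.IsClass.exists_equiv {Γ : Type uΓ} [AddCommGroup Γ] [DecidableEq Γ] {R : Type uR}
    [Ring R] {𝓡 : Γ → AddSubgroup R} [GradedRing 𝓡] {x : Vgr 𝓡} {e e' : R} (hx : x.IsClass e')
    (hx' : x.IsClass e) : ∃ u ∈ 𝓡 0, ∃ v ∈ 𝓡 0, u * e' = u ∧ e * u = u ∧ v * e = v ∧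
      e' * v = v ∧ u * v = e ∧ v * u = e' := by
  rw [← shift_zero x] at hx'
  simpa using (hx.shift_iff 0 e).1 hx'

theorem Vgr.isClass_sum {Γ : Type uΓ} [AddCommGroup Γ] [DecidableEq Γ] {R : Type uR} [Ring R]
    {𝓡 : Γ → AddSubgroup R} {ι : Type*} [DecidableEq ι] (s : Finset ι) (x : ι → Vgr 𝓡) (f : ι → R)
    (hx : ∀ i ∈ s, (x i).IsClass (f i)) (hf : ∀ i ∈ s, ∀ j ∈ s, i ≠ j → f i * f j = 0) :
    (∑ i ∈ s, x i).IsClass (∑ i ∈ s, f i) := by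
  induction s using Finset.induction_on with
  | empty => simpa using isClass_zero
  | insert a s ha ih =>
    rw [Finset.sum_insert ha, Finset.sum_insert ha]
    have hne : ∀ i ∈ s, a ≠ i := fun i hi h => ha (h ▸ hi)
    refine (hx a (Finset.mem_insert_self a s)).add
      (ih (fun i hi => hx i (Finset.mem_insert_of_mem hi)) fun i hi j hj =>
        hf i (Finset.mem_insert_of_mem hi) j (Finset.mem_insert_of_mem hj)) ?_ ?_
    · rw [Finset.mul_sum]
      exact Finset.sum_eq_zero fun i hi => hf a (Finset.mem_insert_self a s) i
        (Finset.mem_insert_of_mem hi) (hne i hi)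
    · rw [Finset.sum_mul]
      exact Finset.sum_eq_zero fun i hi => hf i (Finset.mem_insert_of_mem hi) a
        (Finset.mem_insert_self a s) (hne i hi).symm

/-- `φ` maps homogeneous elements to homogeneous elements of the same degree. -/
def IsGradedMap {Γ T S : Type*} [AddGroup T] [AddGroup S] (𝓣 : Γ → AddSubgroup T)
    (𝓢 : Γ → AddSubgroup S) (φ : T → S) : Prop :=
  ∀ γ x, x ∈ 𝓣 γ → φ x ∈ 𝓢 γ

/-- On the classes of idempotents coming from `T` the map `g` is given by `ι e ↦ φ e`. -/
def IsCompatible {Γ : Type uΓ} [AddCommGroup Γ] [DecidableEq Γ] {R : Type uR} [Ring R]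
    {𝓡 : Γ → AddSubgroup R} {S : Type uS} [Ring S] {𝓢 : Γ → AddSubgroup S} (g : Vgr 𝓡 → Vgr 𝓢)
    {T : Type*} [Ring T] (𝓣 : Γ → AddSubgroup T) (ι : T → R) (φ : T → S) : Prop :=
  ∀ e ∈ 𝓣 0, e * e = e → ∀ x : Vgr 𝓡, x.IsClass (ι e) → (g x).IsClass (φ e)

/-! ### Existence and uniqueness of homomorphisms inducing a given map of classes -/

section

variable {Γ : Type uΓ} [AddCommGroup Γ] [DecidableEq Γ] {A : Type uA} [CommRing A]
  {𝒜 : Γ → AddSubgroup A} [GradedRing 𝒜] {l : ℕ} {n : Fin l → ℕ} {δ : ∀ i, Fin (n i) → Γ}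
  {R : Type uR} [Ring R] [Algebra A R] {𝓡 : Γ → AddSubgroup R} [GradedRing 𝓡]
  {S : Type uS} [Ring S] [Algebra A S] {𝓢 : Γ → AddSubgroup S} [GradedRing 𝓢]

theorem blockUnit_diag_mem (i : Fin l) (j : Fin (n i)) :
    blockUnit i j j 1 ∈ matricialGrading 𝒜 δ 0 :=
  blockUnit_mem (by rw [zero_add, sub_self]; exact SetLike.one_mem_graded 𝒜)

/-- Compatibility may be checked on the diagonal matrix units. -/
theorem isCompatible_of_blockUnit (hA : IsGradedField 𝒜) (g : Vgr 𝓡 →+ Vgr 𝓢)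
    {ι : (∀ i, Matrix (Fin (n i)) (Fin (n i)) A) →ₐ[A] R}
    {φ : (∀ i, Matrix (Fin (n i)) (Fin (n i)) A) →ₐ[A] S}
    (hι : IsGradedMap (matricialGrading 𝒜 δ) 𝓡 ι) (hφ : IsGradedMap (matricialGrading 𝒜 δ) 𝓢 φ)
    (h : ∀ i j, ∀ x : Vgr 𝓡, x.IsClass (ι (blockUnit i j j 1)) →
      (g x).IsClass (φ (blockUnit i j j 1))) :
    IsCompatible g (matricialGrading 𝒜 δ) ι φ := by
  -- Rank-one pieces are split off `e` until nothing is left; `s` contains every column in which `e`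
  -- can be nonzero.
  have main : ∀ (s : Finset (Σ i, Fin (n i))) (e), e ∈ matricialGrading 𝒜 δ 0 → e * e = e →
      (∀ t ∉ s, e * blockUnit t.1 t.2 t.2 1 = 0) → ∀ x : Vgr 𝓡, x.IsClass (ι e) →
      (g x).IsClass (φ e) := by
    intro s
    induction s using Finset.induction_on with
    | empty =>
      intro e he hee hs x hx
      have : e = 0 := by
        rw [← mul_one e, ← sum_blockUnit_diag, Finset.mul_sum]
        exact Finset.sum_eq_zero fun t _ => hs t (Finset.notMem_empty t)
      subst this
      rw [map_zero] at hx ⊢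
      rw [hx.unique Vgr.isClass_zero, map_zero]
      exact Vgr.isClass_zero
    | insert t s ht ih =>
      intro e he hee hs x hx
      by_cases het : e * blockUnit t.1 t.2 t.2 1 = 0
      · refine ih e he hee (fun t' ht' => ?_) x hx
        by_cases h' : t' = t
        · rw [h', het]
        · exact hs t' (by simp [h', ht'])
      obtain ⟨i, k⟩ := t
      obtain ⟨j, hj⟩ : ∃ j, e i j k ≠ 0 := by
        by_contra! hcon
        refine het ?_
        rw [← one_mul (e * _), ← sum_blockUnit_diag, Finset.sum_mul]
        refine Finset.sum_eq_zero fun t' _ => ?_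
        obtain ⟨i', j'⟩ := t'
        dsimp only
        by_cases hi : i' = i
        · subst hi
          rw [← mul_assoc, blockUnit_mul_mul, hcon]
          simp [blockUnit]
        · funext i''
          by_cases h1 : i'' = i
          · subst h1
            simp [blockUnit, Pi.single_eq_of_ne (Ne.symm hi)]
          · simp [blockUnit, Pi.single_eq_of_ne h1]
      obtain ⟨b, hb, hab⟩ := hA.exists_inv (he i j k) hj
      set D := blockUnit i j j (1 : A) with hD
      have hDD : D * D = D := by rw [hD, blockUnit_mul, one_mul]
      set p := e * blockUnit i k j b with hp
      set q := D * e with hq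
      have hbm : blockUnit i k j b ∈ matricialGrading 𝒜 δ 0 := blockUnit_mem (by
        rwa [show 0 + δ i j - δ i k = -(0 + δ i k - δ i j) by abel])
      have hpm : p ∈ matricialGrading 𝒜 δ 0 := by
        simpa using matricialGrading_mul_mem he hbm
      have hDm : D ∈ matricialGrading 𝒜 δ 0 := blockUnit_diag_mem i j
      have hqm : q ∈ matricialGrading 𝒜 δ 0 := by
        simpa using matricialGrading_mul_mem hDm he
      have hep : e * p = p := by rw [hp, ← mul_assoc, hee]
      have hqe : q * e = q := by rw [hq, mul_assoc, hee]
      have hpD : p * D = p := by rw [hp, hD, mul_assoc, blockUnit_mul, mul_one]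
      have hDq : D * q = q := by rw [hq, ← mul_assoc, hDD]
      have hqp : q * p = D := by
        rw [hq, mul_assoc, hep, hp, ← mul_assoc, hD, blockUnit_mul_mul, one_mul, hab]
      -- As `q p = D`, the element `f = p q` is an idempotent under `e` equivalent in degree zero to
      -- the diagonal unit `D`. Subtracting `f` from `e` clears column `k` of block `i` and creates
      -- no new nonzero column.
      set f := p * q with hf
      have hff : f * f = f := by
        rw [hf, mul_assoc, ← mul_assoc q p q, hqp, hDq]
      have hef : e * f = f := by rw [hf, ← mul_assoc, hep]
      have hfe : f * e = f := by rw [hf, mul_assoc, hqe]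
      have hfm : f ∈ matricialGrading 𝒜 δ 0 := by
        simpa using matricialGrading_mul_mem hpm hqm
      have he'm : e - f ∈ matricialGrading 𝒜 δ 0 := sub_mem he hfm
      have he'e' : (e - f) * (e - f) = e - f := by
        rw [sub_mul, mul_sub, mul_sub, hee, hef, hfe, hff]; abel
      have hff' : f * (e - f) = 0 := by rw [mul_sub, hfe, hff, sub_self]
      have hf'f : (e - f) * f = 0 := by rw [sub_mul, hef, hff, sub_self]
      have hzero : ∀ t' ∉ s, (e - f) * blockUnit t'.1 t'.2 t'.2 1 = 0 := by
        intro t' ht'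
        by_cases h' : t' = ⟨i, k⟩
        · subst h'
          have h2 : q * blockUnit i k k 1 = blockUnit i j k (e i j k) := by
            rw [hq, hD, blockUnit_mul_mul, one_mul, mul_one]
          rw [sub_mul, hf, mul_assoc, h2, hp, mul_assoc, blockUnit_mul, mul_comm b, hab, sub_self]
        · have h3 := hs t' (by simp [h', ht'])
          rw [sub_mul, h3, hf, hq, mul_assoc p, mul_assoc D, h3, mul_zero, mul_zero, sub_self]
      obtain ⟨x₁, hx₁⟩ := Vgr.exists_isClass (𝓡 := 𝓡) (hι 0 D hDm) (by rw [← map_mul, hDD])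
      have hx₁f : x₁.IsClass (ι f) := hx₁.of_equiv (hι 0 p hpm) (hι 0 q hqm)
        (by rw [← map_mul, hpD]) (by rw [← map_mul, hf, mul_assoc, hqp, hpD])
        (by rw [← map_mul, hf, ← mul_assoc, hqp, hDq]) (by rw [← map_mul, hDq])
        (by rw [← map_mul]) (by rw [← map_mul, hqp])
      obtain ⟨x₂, hx₂⟩ := Vgr.exists_isClass (𝓡 := 𝓡) (hι 0 _ he'm) (by rw [← map_mul, he'e'])
      have hsum : (x₁ + x₂).IsClass (ι e) := by
        have := hx₁f.add hx₂ (by rw [← map_mul, hff', map_zero]) (by rw [← map_mul, hf'f, map_zero])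
        rwa [← map_add, add_sub_cancel] at this
      have hg₁ : (g x₁).IsClass (φ f) := (h i j x₁ hx₁).of_equiv (hφ 0 p hpm) (hφ 0 q hqm)
        (by rw [← map_mul, hpD]) (by rw [← map_mul, hf, mul_assoc, hqp, hpD])
        (by rw [← map_mul, hf, ← mul_assoc, hqp, hDq]) (by rw [← map_mul, hDq])
        (by rw [← map_mul]) (by rw [← map_mul, hqp])
      have hg₂ := ih (e - f) he'm he'e' hzero x₂ hx₂
      have := hg₁.add hg₂ (by rw [← map_mul, hff', map_zero]) (by rw [← map_mul, hf'f, map_zero])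
      rw [← map_add φ, add_sub_cancel] at this
      rwa [hx.unique hsum, map_add]
  exact fun e he hee => main Finset.univ e he hee fun t ht => (ht (Finset.mem_univ t)).elim

/-- The first position in a nonempty block. -/
def blockBase {m : ℕ} (j : Fin m) : Fin m := ⟨0, j.pos⟩

/-- Graded homomorphisms that agree on the classes of idempotents are conjugate. -/
theorem exists_conj_of_isClass {φ ψ : (∀ i, Matrix (Fin (n i)) (Fin (n i)) A) →ₐ[A] R}
    (hφ : IsGradedMap (matricialGrading 𝒜 δ) 𝓡 φ) (hψ : IsGradedMap (matricialGrading 𝒜 δ) 𝓡 ψ)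
    (h : ∀ i j, ∃ x : Vgr 𝓡, x.IsClass (φ (blockUnit i j j 1)) ∧
      x.IsClass (ψ (blockUnit i j j 1))) :
    ∃ u ∈ 𝓡 0, ∃ v ∈ 𝓡 0, u * v = 1 ∧ v * u = 1 ∧ ∀ b, u * φ b * v = ψ b := by
  have h' : ∀ t : Σ i, Fin (n i), ∃ u ∈ 𝓡 0, ∃ v ∈ 𝓡 0, u * v = ψ (blockUnit t.1 t.2 t.2 1) ∧
      v * u = φ (blockUnit t.1 t.2 t.2 1) := fun t => by
    obtain ⟨x, h1, h2⟩ := h t.1 t.2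
    obtain ⟨u, hu, v, hv, -, -, -, -, huv, hvu⟩ := h1.exists_equiv h2
    exact ⟨u, hu, v, hv, huv, hvu⟩
  choose u hu v hv huv hvu using h'
  -- The conjugating unit uses only the equivalences at the base position of each block, carried to
  -- the other positions by matrix units: separately chosen equivalences at all positions need not
  -- be coherent.
  let z : (Σ i, Fin (n i)) → Σ i, Fin (n i) := fun t => ⟨t.1, blockBase t.2⟩
  let col : (Σ i, Fin (n i)) → ∀ i, Matrix (Fin (n i)) (Fin (n i)) A := fun t =>
    blockUnit t.1 t.2 (blockBase t.2) 1
  let row : (Σ i, Fin (n i)) → ∀ i, Matrix (Fin (n i)) (Fin (n i)) A := fun t =>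
    blockUnit t.1 (blockBase t.2) t.2 1
  have hcol : ∀ t, col t ∈ matricialGrading 𝒜 δ (δ t.1 t.2 - δ t.1 (blockBase t.2)) := fun t =>
    blockUnit_mem (by simpa using SetLike.one_mem_graded 𝒜)
  have hrow : ∀ t, row t ∈ matricialGrading 𝒜 δ (δ t.1 (blockBase t.2) - δ t.1 t.2) := fun t =>
    blockUnit_mem (by simpa using SetLike.one_mem_graded 𝒜)
  have hrc : ∀ t, row t * col t = blockUnit t.1 (blockBase t.2) (blockBase t.2) 1 := fun t => by
    rw [blockUnit_mul, one_mul]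
  have hrc' : ∀ t t', t ≠ t' → row t * col t' = 0 := fun t t' ht => blockUnit_mul_of_ne ht _ _ _ _
  have hcd : ∀ t, col t * (row t * col t) * row t = blockUnit t.1 t.2 t.2 1 := fun t => by
    rw [hrc, blockUnit_mul, blockUnit_mul, one_mul, one_mul]
  have inv : ∀ (φ ψ : (∀ i, Matrix (Fin (n i)) (Fin (n i)) A) →ₐ[A] R)
      (u v : (Σ i, Fin (n i)) → R), (∀ t, u t * v t = ψ (blockUnit t.1 t.2 t.2 1)) →
      (∀ t, v t * u t = φ (blockUnit t.1 t.2 t.2 1)) →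
      (∑ t, ψ (col t) * u (z t) * φ (row t)) * (∑ t, φ (col t) * v (z t) * ψ (row t)) = 1 := by
    intro φ ψ u v huv hvu
    rw [Finset.sum_mul]
    calc _ = ∑ t, ψ (blockUnit t.1 t.2 t.2 1) := Finset.sum_congr rfl fun t _ => by
          rw [Finset.mul_sum, Finset.sum_eq_single_of_mem t (Finset.mem_univ t)]
          · have h1 : φ (row t) * φ (col t) = v (z t) * u (z t) := by
              rw [← map_mul, hrc, hvu]
            have h2 : u (z t) * v (z t) = ψ (row t * col t) := by rw [hrc, huv]
            calc _ = ψ (col t) * u (z t) * (φ (row t) * φ (col t)) * v (z t) * ψ (row t) := by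
                  noncomm_ring
              _ = ψ (col t) * (u (z t) * v (z t)) * (u (z t) * v (z t)) * ψ (row t) := by
                  rw [h1]; noncomm_ring
              _ = ψ (col t * (row t * col t) * row t) := by
                  rw [h2, ← map_mul, ← map_mul, ← map_mul, hrc, mul_assoc (col t),
                    blockUnit_mul, one_mul]
              _ = _ := by rw [hcd]
          · intro t' _ ht'
            calc _ = ψ (col t) * u (z t) * (φ (row t) * φ (col t')) * v (z t') * ψ (row t') := by
                  noncomm_ring
              _ = 0 := by rw [← map_mul, hrc' t t' ht'.symm]; simp
      _ = 1 := by rw [← map_sum, sum_blockUnit_diag, map_one]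
  have hUV := inv φ ψ u v huv hvu
  have hVU := inv ψ φ v u hvu huv
  set U := ∑ t, ψ (col t) * u (z t) * φ (row t) with hU
  set V := ∑ t, φ (col t) * v (z t) * ψ (row t) with hV
  have hmem : ∀ (φ ψ : (∀ i, Matrix (Fin (n i)) (Fin (n i)) A) →ₐ[A] R)
      (u : (Σ i, Fin (n i)) → R), IsGradedMap (matricialGrading 𝒜 δ) 𝓡 φ →
      IsGradedMap (matricialGrading 𝒜 δ) 𝓡 ψ → (∀ t, u t ∈ 𝓡 0) →
      ∑ t, ψ (col t) * u (z t) * φ (row t) ∈ 𝓡 0 := by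
    intro φ ψ u hφ hψ hu
    refine sum_mem fun t _ => ?_
    have := SetLike.mul_mem_graded (SetLike.mul_mem_graded (hψ _ _ (hcol t)) (hu (z t)))
      (hφ _ _ (hrow t))
    simpa using this
  -- Both sides are linear in `b`, and on a matrix unit `(j, k)` one term of each sum survives, the
  -- same on both sides.
  have hcomm : ∀ b, U * φ b = ψ b * U := by
    have : (LinearMap.mulLeft A U ∘ₗ φ.toLinearMap) = LinearMap.mulRight A U ∘ₗ ψ.toLinearMap := by
      refine eq_of_forall_blockUnit fun i j k => ?_
      change U * φ (blockUnit i j k 1) = ψ (blockUnit i j k 1) * U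
      rw [hU, Finset.sum_mul, Finset.mul_sum,
        Finset.sum_eq_single_of_mem ⟨i, j⟩ (Finset.mem_univ _),
        Finset.sum_eq_single_of_mem ⟨i, k⟩ (Finset.mem_univ _)]
      · rw [mul_assoc, ← map_mul, ← mul_assoc, ← mul_assoc, ← map_mul]
        simp only [row, col]
        rw [blockUnit_mul, blockUnit_mul, one_mul]
        rfl
      · intro t _ ht
        rw [← mul_assoc, ← mul_assoc, ← map_mul, blockUnit_mul_of_ne ht.symm, map_zero, zero_mul,
          zero_mul]
      · intro t _ ht
        rw [mul_assoc, ← map_mul, blockUnit_mul_of_ne ht, map_zero, mul_zero]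
    exact fun b => LinearMap.congr_fun this b
  refine ⟨U, hmem φ ψ u hφ hψ hu, V, hmem ψ φ v hψ hφ hv, hUV, hVU, fun b => ?_⟩
  rw [hcomm, mul_assoc, hUV, mul_one]

/-- A shift-equivariant unital map of class monoids is realised on a graded matricial algebra. -/
theorem exists_isCompatible_blockUnit (hS : IsGradedAlgebra 𝒜 𝓢) (hA : IsGradedField 𝒜)
    (g : Vgr 𝓡 →+ Vgr 𝓢) (hg : ∀ γ x, g (Vgr.shift γ x) = Vgr.shift γ (g x))
    (hg1 : g (Vgr.mk (GrProj.regular 𝓡)) = Vgr.mk (GrProj.regular 𝓢))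
    {ι : (∀ i, Matrix (Fin (n i)) (Fin (n i)) A) →ₐ[A] R}
    (hι : IsGradedMap (matricialGrading 𝒜 δ) 𝓡 ι) :
    ∃ φ : (∀ i, Matrix (Fin (n i)) (Fin (n i)) A) →ₐ[A] S,
      IsGradedMap (matricialGrading 𝒜 δ) 𝓢 φ ∧ IsCompatible g (matricialGrading 𝒜 δ) ι φ := by
  have hx : ∀ t : Σ i, Fin (n i), ∃ x : Vgr 𝓡, x.IsClass (ι (blockUnit t.1 t.2 t.2 1)) := fun t =>
    Vgr.exists_isClass (hι 0 _ (blockUnit_diag_mem _ _)) (by rw [← map_mul, blockUnit_mul, one_mul])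
  choose x hx using hx
  -- The diagonal units sum to `1`, so their classes sum to `[R]`; unitality of `g` makes the image
  -- sum `[S]`, which therefore splits inside `S`.
  have hsum : (∑ t, g (x t)).IsClass (1 : S) := by
    have h1 := Vgr.isClass_sum Finset.univ x _ (fun t _ => hx t) fun t _ t' _ ht => by
      rw [← map_mul, blockUnit_mul_of_ne ht, map_zero]
    rw [← map_sum ι, sum_blockUnit_diag, map_one] at h1
    rw [← map_sum, h1.unique Vgr.isClass_one, hg1]
    exact Vgr.isClass_one
  obtain ⟨f, hf, hff, hf1⟩ := hsum.exists_of_sum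
  replace hf := fun t => hf t (Finset.mem_univ t)
  replace hff := fun t t' => hff t (Finset.mem_univ t) t' (Finset.mem_univ t')
  -- Matrix units between a position and the base are homogeneous with degree the difference of the
  -- two entries of `δ`; hence the diagonal classes of one block are shifts of each other.
  have hshift : ∀ t : Σ i, Fin (n i),
      x t = Vgr.shift (δ t.1 (blockBase t.2) - δ t.1 t.2) (x ⟨t.1, blockBase t.2⟩) := fun t => by
    refine (hx t).unique (((hx ⟨t.1, blockBase t.2⟩).shift_iff _ _).2
      ⟨ι (blockUnit t.1 t.2 (blockBase t.2) 1), hι _ _ (blockUnit_mem ?_),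
        ι (blockUnit t.1 (blockBase t.2) t.2 1), hι _ _ (blockUnit_mem ?_), ?_⟩)
    · simpa using SetLike.one_mem_graded 𝒜
    · simpa using SetLike.one_mem_graded 𝒜
    · simp only [← map_mul, blockUnit_mul, one_mul, and_self]
  have hequiv : ∀ t : Σ i, Fin (n i), ∃ u ∈ 𝓢 (-(δ t.1 (blockBase t.2) - δ t.1 t.2)),
      ∃ v ∈ 𝓢 (δ t.1 (blockBase t.2) - δ t.1 t.2),
        u * f ⟨t.1, blockBase t.2⟩ = u ∧ f t * u = u ∧ v * f t = v ∧
        f ⟨t.1, blockBase t.2⟩ * v = v ∧ u * v = f t ∧ v * u = f ⟨t.1, blockBase t.2⟩ := fun t => by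
    refine ((hf ⟨t.1, blockBase t.2⟩).shift_iff _ _).1 ?_
    rw [← hg, ← hshift]
    exact hf t
  choose u hu v hv h1 h2 h3 h4 h5 h6 using hequiv
  -- Passing through the base position makes these elements a coherent system of matrix units; the
  -- base degree cancels, so `w i j k` has degree `δ i j - δ i k`, as in the source.
  let w : ∀ i, Fin (n i) → Fin (n i) → S := fun i j k => u ⟨i, j⟩ * v ⟨i, k⟩
  have hww : ∀ i j k m, w i j k * w i k m = w i j m := fun i j k m => by
    calc _ = u ⟨i, j⟩ * (v ⟨i, k⟩ * u ⟨i, k⟩) * v ⟨i, m⟩ := by simp only [w]; noncomm_ring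
      _ = _ := by
        rw [h6]
        exact congrArg (· * _) (h1 ⟨i, j⟩)
  have hww' : ∀ i j k i' k' m, (⟨i, k⟩ : Σ i, Fin (n i)) ≠ ⟨i', k'⟩ →
      w i j k * w i' k' m = 0 := fun i j k i' k' m hne => by
    simp only [w]
    rw [← h3 ⟨i, k⟩, ← h2 ⟨i', k'⟩]
    calc _ = u ⟨i, j⟩ * v ⟨i, k⟩ * (f ⟨i, k⟩ * f ⟨i', k'⟩) * u ⟨i', k'⟩ * v ⟨i', m⟩ := by
          noncomm_ring
      _ = 0 := by rw [hff _ _ hne]; simp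
  let L : (∀ i, Matrix (Fin (n i)) (Fin (n i)) A) →ₗ[A] S :=
    { toFun := fun x => ∑ i, ∑ j, ∑ k, x i j k • w i j k
      map_add' := fun x y => by simp [add_smul, Finset.sum_add_distrib]
      map_smul' := fun a x => by simp [Finset.smul_sum, mul_smul] }
  have hL : ∀ x, L x = ∑ i, ∑ j, ∑ k, x i j k • w i j k := fun x => rfl
  have hLu : ∀ i j k, L (blockUnit i j k 1) = w i j k := fun i j k => by
    rw [hL, Finset.sum_eq_single_of_mem i (Finset.mem_univ i)]
    · simp [blockUnit, Matrix.single_apply, ite_and]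
    · intro i' _ hi
      simp [blockUnit, Pi.single_eq_of_ne hi]
  have hL1 : L 1 = 1 := by
    rw [← sum_blockUnit_diag, map_sum, ← hf1]
    exact Finset.sum_congr rfl fun t _ => (hLu _ _ _).trans (h5 t)
  have hLm : ∀ x y, L (x * y) = L x * L y := by
    have key : ∀ i j k i' j' k', L (blockUnit i j k 1 * blockUnit i' j' k' 1) =
        L (blockUnit i j k 1) * L (blockUnit i' j' k' 1) := by
      intro i j k i' j' k'
      rw [hLu, hLu]
      by_cases hne : (⟨i, k⟩ : Σ i, Fin (n i)) = ⟨i', j'⟩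
      · obtain ⟨rfl, h⟩ := Sigma.mk.inj_iff.1 hne
        obtain rfl := eq_of_heq h
        rw [blockUnit_mul, one_mul, hLu, hww]
      · rw [blockUnit_mul_of_ne hne, map_zero, hww' _ _ _ _ _ _ hne]
    intro x y
    have h1 : ∀ i j k y, L (blockUnit i j k 1 * y) = L (blockUnit i j k 1) * L y := by
      intro i j k y
      have : L ∘ₗ LinearMap.mulLeft A (blockUnit i j k 1) =
          LinearMap.mulLeft A (L (blockUnit i j k 1)) ∘ₗ L :=
        eq_of_forall_blockUnit fun i' j' k' => key i j k i' j' k'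
      exact LinearMap.congr_fun this y
    have : L ∘ₗ LinearMap.mulRight A y = LinearMap.mulRight A (L y) ∘ₗ L :=
      eq_of_forall_blockUnit fun i j k => h1 i j k y
    exact LinearMap.congr_fun this x
  let φ : (∀ i, Matrix (Fin (n i)) (Fin (n i)) A) →ₐ[A] S := AlgHom.ofLinearMap L hL1 hLm
  have hφ : IsGradedMap (matricialGrading 𝒜 δ) 𝓢 φ := by
    intro γ y hy
    change ∑ i, ∑ j, ∑ k, y i j k • w i j k ∈ 𝓢 γ
    refine sum_mem fun i _ => sum_mem fun j _ => sum_mem fun k _ => ?_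
    rw [Algebra.smul_def]
    have := SetLike.mul_mem_graded (hS _ _ (hy i j k))
      (SetLike.mul_mem_graded (hu ⟨i, j⟩) (hv ⟨i, k⟩))
    have h0 : γ + δ i k - δ i j + (-(δ i (blockBase j) - δ i j) + (δ i (blockBase k) - δ i k)) =
        γ := by
      rw [show blockBase k = blockBase j from rfl]; abel
    rwa [h0] at this
  refine ⟨φ, hφ, isCompatible_of_blockUnit hA g hι hφ fun i j y hy => ?_⟩
  rw [hy.unique (hx ⟨i, j⟩), show φ (blockUnit i j j 1) = f ⟨i, j⟩ from (hLu i j j).trans (h5 ⟨i, j⟩)]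
  exact hf ⟨i, j⟩

end

/-! ### Limits of intertwined sequences -/

/-- Each step gives both the inclusion of consecutive stages and the agreement of the maps on them,
so a value computed at any stage containing `x` is the same. -/
theorem exists_extension_of_chain {A R S : Type*} [CommRing A] [Ring R] [Algebra A R] [Ring S]
    [Algebra A S] {K : ℕ → Subalgebra A R} (φ : ∀ k, K k →ₐ[A] S)
    (h : ∀ k (x : K k), ∃ hx : (x : R) ∈ K (k + 1), φ (k + 1) ⟨x, hx⟩ = φ k x)
    (hK : ∀ x, ∃ k, x ∈ K k) :
    Monotone K ∧ ∃ F : R → S, ∀ k (x : K k), F x = φ k x := by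
  have hle : ∀ i j, i ≤ j → ∀ x : K i, ∃ hx : (x : R) ∈ K j, φ j ⟨x, hx⟩ = φ i x := by
    intro i j hij x
    induction j, hij using Nat.le_induction with
    | base => exact ⟨x.2, rfl⟩
    | succ j _ ih =>
      obtain ⟨hx, hφ⟩ := ih
      obtain ⟨hx', hφ'⟩ := h j ⟨x, hx⟩
      exact ⟨hx', hφ'.trans hφ⟩
  choose c hc using hK
  refine ⟨fun i j hij x hx => (hle i j hij ⟨x, hx⟩).1, fun x => φ (c x) ⟨x, hc x⟩, fun k x => ?_⟩
  rcases le_total (c x) k with hk | hk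
  · exact ((hle _ _ hk ⟨x, hc x⟩).2).symm
  · exact (hle _ _ hk x).2

/-- Two intertwined sequences of homomorphisms define an isomorphism of the unions. -/
theorem exists_algEquiv_of_intertwined {A R S : Type*} [CommRing A] [Ring R] [Algebra A R] [Ring S]
    [Algebra A S] {K : ℕ → Subalgebra A R} {L : ℕ → Subalgebra A S} (φ : ∀ k, K k →ₐ[A] S)
    (ψ : ∀ k, L k →ₐ[A] R) (h₁ : ∀ k x, ∃ h : φ k x ∈ L k, ψ k ⟨φ k x, h⟩ = x)
    (h₂ : ∀ k y, ∃ h : ψ k y ∈ K (k + 1), φ (k + 1) ⟨ψ k y, h⟩ = y)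
    (hK : ∀ x, ∃ k, x ∈ K k) (hL : ∀ y, ∃ k, y ∈ L k) :
    ∃ e : R ≃ₐ[A] S, (∀ k (x : K k), e x = φ k x) ∧ ∀ k (y : L k), e.symm y = ψ k y := by
  -- Writing `x` as `ψ k (φ k x)` shows that it lies in the next stage and that `φ (k + 1)` sends it
  -- to `φ k x`.
  obtain ⟨hKm, F, hF⟩ := exists_extension_of_chain φ (fun k x => by
    obtain ⟨hx, hψ⟩ := h₁ k x
    obtain ⟨hy, hφ⟩ := h₂ k ⟨_, hx⟩
    simp only [hψ] at hy hφ
    exact ⟨hy, hφ⟩) hK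
  obtain ⟨-, G, hG⟩ := exists_extension_of_chain ψ (fun k y => by
    obtain ⟨hy, hφ⟩ := h₂ k y
    obtain ⟨hx, hψ⟩ := h₁ (k + 1) ⟨_, hy⟩
    simp only [hφ] at hx hψ
    exact ⟨hx, hψ⟩) hL
  have hpair : ∀ x y : R, ∃ k, x ∈ K k ∧ y ∈ K k := fun x y => by
    obtain ⟨i, hi⟩ := hK x
    obtain ⟨j, hj⟩ := hK y
    exact ⟨max i j, hKm (le_max_left i j) hi, hKm (le_max_right i j) hj⟩
  have hGF : ∀ x, G (F x) = x := fun x => by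
    obtain ⟨k, hk⟩ := hK x
    obtain ⟨hx, hψ⟩ := h₁ k ⟨x, hk⟩
    rw [hF k ⟨x, hk⟩]
    exact (hG k ⟨_, hx⟩).trans hψ
  have hFG : ∀ y, F (G y) = y := fun y => by
    obtain ⟨k, hk⟩ := hL y
    obtain ⟨hy, hφ⟩ := h₂ k ⟨y, hk⟩
    rw [hG k ⟨y, hk⟩]
    exact (hF (k + 1) ⟨_, hy⟩).trans hφ
  refine ⟨{ toFun := F, invFun := G, left_inv := hGF, right_inv := hFG, map_mul' := fun x y => ?_,
            map_add' := fun x y => ?_, commutes' := fun a => ?_ }, hF, hG⟩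
  · obtain ⟨k, hx, hy⟩ := hpair x y
    rw [hF k ⟨x, hx⟩, hF k ⟨y, hy⟩, ← map_mul]
    exact hF k (⟨x, hx⟩ * ⟨y, hy⟩)
  · obtain ⟨k, hx, hy⟩ := hpair x y
    rw [hF k ⟨x, hx⟩, hF k ⟨y, hy⟩, ← map_add]
    exact hF k (⟨x, hx⟩ + ⟨y, hy⟩)
  · exact (hF 0 (algebraMap A (K 0) a)).trans ((φ 0).commutes a)

/-! ### The intertwining argument -/

theorem IsGradedMatricial.finite {Γ : Type*} [AddCommGroup Γ] {A : Type*} [CommRing A]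
    {𝒜 : Γ → AddSubgroup A} {T : Type*} [Ring T] [Algebra A T] {𝓣 : Γ → AddSubgroup T}
    (hT : IsGradedMatricial 𝒜 𝓣) : Module.Finite A T := by
  obtain ⟨l, n, δ, e, -⟩ := hT
  exact Module.Finite.equiv e.toLinearEquiv

section

variable {Γ : Type uΓ} [AddCommGroup Γ] [DecidableEq Γ] {A : Type uA} [CommRing A]
  {𝒜 : Γ → AddSubgroup A} [GradedRing 𝒜]
  {R : Type uR} [Ring R] [Algebra A R] {𝓡 : Γ → AddSubgroup R} [GradedRing 𝓡]
  {S : Type uS} [Ring S] [Algebra A S] {𝓢 : Γ → AddSubgroup S} [GradedRing 𝓢]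

theorem IsGradedMatricial.exists_isCompatible {U : Subalgebra A R}
    (hU : IsGradedMatricial 𝒜 (subalgebraGrading 𝓡 U)) (hA : IsGradedField 𝒜)
    (hS : IsGradedAlgebra 𝒜 𝓢) (g : Vgr 𝓡 →+ Vgr 𝓢)
    (hg : ∀ γ x, g (Vgr.shift γ x) = Vgr.shift γ (g x))
    (hg1 : g (Vgr.mk (GrProj.regular 𝓡)) = Vgr.mk (GrProj.regular 𝓢)) :
    ∃ φ : U →ₐ[A] S, IsGradedMap (subalgebraGrading 𝓡 U) 𝓢 φ ∧
      IsCompatible g (subalgebraGrading 𝓡 U) U.val φ := by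
  obtain ⟨l, n, δ, e, he⟩ := hU
  obtain ⟨φ, hφ, hc⟩ := exists_isCompatible_blockUnit hS hA g hg hg1 (ι := U.val.comp e.toAlgHom)
    fun γ x hx => (he γ x).1 hx
  have he' : ∀ γ x, x ∈ subalgebraGrading 𝓡 U γ → e.symm x ∈ matricialGrading 𝒜 δ γ :=
    fun γ x hx => (he γ _).2 (by rwa [e.apply_symm_apply])
  refine ⟨φ.comp e.symm.toAlgHom, fun γ x hx => hφ γ _ (he' γ x hx), fun p hp hpp x hx => ?_⟩
  refine hc (e.symm p) (he' 0 p hp) (by rw [← map_mul, hpp]) x ?_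
  change x.IsClass ((e (e.symm p) : U) : R)
  rwa [e.apply_symm_apply]

theorem IsGradedMatricial.exists_conj {T : Type*} [Ring T] [Algebra A T] {𝓣 : Γ → AddSubgroup T}
    (hT : IsGradedMatricial 𝒜 𝓣) {φ ψ : T →ₐ[A] R} (hφ : IsGradedMap 𝓣 𝓡 φ)
    (hψ : IsGradedMap 𝓣 𝓡 ψ)
    (h : ∀ e ∈ 𝓣 0, e * e = e → ∃ x : Vgr 𝓡, x.IsClass (φ e) ∧ x.IsClass (ψ e)) :
    ∃ u ∈ 𝓡 0, ∃ v ∈ 𝓡 0, u * v = 1 ∧ v * u = 1 ∧ ∀ b, u * φ b * v = ψ b := by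
  obtain ⟨l, n, δ, e, he⟩ := hT
  obtain ⟨u, hu, v, hv, huv, hvu, hc⟩ := exists_conj_of_isClass (𝓡 := 𝓡)
    (φ := φ.comp e.toAlgHom) (ψ := ψ.comp e.toAlgHom) (fun γ x hx => hφ γ _ ((he γ x).1 hx))
    (fun γ x hx => hψ γ _ ((he γ x).1 hx))
    fun i j => h _ ((he 0 _).1 (blockUnit_diag_mem i j)) (by
      change e _ * e _ = e _
      rw [← map_mul, blockUnit_mul, one_mul])
  refine ⟨u, hu, v, hv, huv, hvu, fun b => ?_⟩
  have := hc (e.symm b)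
  change u * φ (e (e.symm b)) * v = ψ (e (e.symm b)) at this
  rwa [e.apply_symm_apply] at this

theorem exists_range_le_of_finite {A T S : Type*} [CommRing A] [Ring T] [Algebra A T] [Ring S]
    [Algebra A S] [Module.Finite A T] (φ : T →ₐ[A] S) {L : ℕ → Subalgebra A S} (hL : Monotone L)
    (hex : ∀ y, ∃ k, y ∈ L k) (N : ℕ) : ∃ k, N ≤ k ∧ ∀ x, φ x ∈ L k := by
  obtain ⟨s, hs⟩ := Module.Finite.fg_top (R := A) (M := T)
  choose c hc using hex
  refine ⟨max N (s.sup fun x => c (φ x)), le_max_left _ _, fun x => ?_⟩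
  have hx : x ∈ Submodule.span A (s : Set T) := hs ▸ Submodule.mem_top
  induction hx using Submodule.span_induction with
  | mem x hx =>
    exact hL ((Finset.le_sup (f := fun x => c (φ x)) hx).trans (le_max_right _ _)) (hc _)
  | zero => rw [map_zero]; exact zero_mem _
  | add x y _ _ hx hy => rw [map_add]; exact add_mem hx hy
  | smul a x _ hx => rw [map_smul]; exact Subalgebra.smul_mem _ hx a

/-- A homomorphism compatible with an isomorphism `g` of class monoids has a left inverse
compatible with the inverse of `g`. -/
theorem exists_leftInverse_of_isCompatible (hA : IsGradedField 𝒜) (hR : IsGradedAlgebra 𝒜 𝓡)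
    (g : Vgr 𝓡 ≃+ Vgr 𝓢) (hg : ∀ γ x, g (Vgr.shift γ x) = Vgr.shift γ (g x))
    (hg1 : g (Vgr.mk (GrProj.regular 𝓡)) = Vgr.mk (GrProj.regular 𝓢)) {U : Subalgebra A R}
    (hU : IsGradedMatricial 𝒜 (subalgebraGrading 𝓡 U)) {W : Subalgebra A S}
    (hW : IsGradedMatricial 𝒜 (subalgebraGrading 𝓢 W)) {φ : U →ₐ[A] S}
    (hφ : IsGradedMap (subalgebraGrading 𝓡 U) 𝓢 φ)
    (hφg : IsCompatible g (subalgebraGrading 𝓡 U) U.val φ) (hφW : ∀ x, φ x ∈ W) :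
    ∃ ψ : W →ₐ[A] R, IsGradedMap (subalgebraGrading 𝓢 W) 𝓡 ψ ∧
      IsCompatible g.symm (subalgebraGrading 𝓢 W) W.val ψ ∧ ∀ x, ψ ⟨φ x, hφW x⟩ = x := by
  obtain ⟨ψ, hψ, hψg⟩ := hW.exists_isCompatible hA hR g.symm.toAddMonoidHom
    (fun γ x => g.injective (by
      change g (g.symm _) = g (Vgr.shift γ (g.symm x))
      rw [hg, g.apply_symm_apply, g.apply_symm_apply]))
    (by rw [← hg1]; exact g.symm_apply_apply _)
  -- On classes `ψ ∘ φ` induces `g` followed by its inverse, so uniqueness makes it conjugate to the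
  -- inclusion of `U`.
  obtain ⟨u, hu, v, hv, huv, hvu, hc⟩ := hU.exists_conj (𝓡 := 𝓡)
    (φ := ψ.comp (φ.codRestrict W hφW)) (ψ := U.val) (fun γ x hx => hψ γ _ (hφ γ x hx))
    (fun _ _ hx => hx) fun e he hee => by
      have hee' : φ e * φ e = φ e := by rw [← map_mul, hee]
      obtain ⟨x, hx⟩ := Vgr.exists_isClass (𝓡 := 𝓡) (e := (e : R)) he (congrArg Subtype.val hee)
      refine ⟨x, ?_, hx⟩
      have := hψg ⟨φ e, hφW e⟩ (hφ 0 e he) (Subtype.ext hee') (g x) (hφg e he hee x hx)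
      rwa [show g.symm.toAddMonoidHom (g x) = x from g.symm_apply_apply x] at this
  -- Conjugating `ψ` turns the left inverse up to conjugation into an exact one, without changing
  -- degrees or classes.
  let ψ' : W →ₐ[A] R :=
    { toFun := fun y => u * ψ y * v
      map_one' := by rw [map_one, mul_one, huv]
      map_mul' := fun x y => by
        rw [map_mul, show u * ψ x * v * (u * ψ y * v) = u * ψ x * (v * u) * ψ y * v by
          noncomm_ring, hvu]
        noncomm_ring
      map_zero' := by simp
      map_add' := fun x y => by rw [map_add]; noncomm_ring
      commutes' := fun a => by
        rw [AlgHom.commutes, ← Algebra.commutes, mul_assoc, huv, mul_one] }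
  refine ⟨ψ', fun γ y hy => ?_, fun e he hee y hy => ?_, hc⟩
  · have := SetLike.mul_mem_graded (SetLike.mul_mem_graded hu (hψ γ y hy)) hv
    rwa [zero_add, add_zero] at this
  · have h1 := hψg e he hee y hy
    have hE : ψ e * ψ e = ψ e := by rw [← map_mul, hee]
    have hm := hψ 0 e he
    change (g.symm y).IsClass (u * ψ e * v)
    refine Vgr.IsClass.of_equiv h1 (u := u * ψ e) (v := ψ e * v)
      (by simpa using SetLike.mul_mem_graded hu hm) (by simpa using SetLike.mul_mem_graded hm hv)
      ?_ ?_ ?_ ?_ ?_ ?_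
    · rw [mul_assoc, hE]
    · rw [show u * ψ e * v * (u * ψ e) = u * ψ e * (v * u) * ψ e by noncomm_ring, hvu, mul_one,
        mul_assoc, hE]
    · rw [show ψ e * v * (u * ψ e * v) = ψ e * (v * u) * ψ e * v by noncomm_ring, hvu, mul_one, hE]
    · rw [← mul_assoc, hE]
    · rw [show u * ψ e * (ψ e * v) = u * (ψ e * ψ e) * v by noncomm_ring, hE]
    · rw [show ψ e * v * (u * ψ e) = ψ e * (v * u) * ψ e by noncomm_ring, hvu, mul_one, hE]

/-- Back and forth between the two chains: a homomorphism from a stage has finitely generated image,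
hence lands in a stage of the other chain, where it acquires a left inverse of the same kind. The
limit is graded because the maps at all stages are. -/
theorem exists_gradedAlgEquiv_of_addEquiv (hA : IsGradedField 𝒜)
    (hR : IsGradedUltramatricial 𝒜 𝓡) (hS : IsGradedUltramatricial 𝒜 𝓢) (g : Vgr 𝓡 ≃+ Vgr 𝓢)
    (hg : ∀ γ x, g (Vgr.shift γ x) = Vgr.shift γ (g x))
    (hg1 : g (Vgr.mk (GrProj.regular 𝓡)) = Vgr.mk (GrProj.regular 𝓢)) :
    ∃ e : R ≃ₐ[A] S, IsGradedAlgEquiv 𝓡 𝓢 e := by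
  obtain ⟨T, hTm, -, hT, hTex⟩ := hR.exists_chain
  obtain ⟨T', hTm', -, hT', hTex'⟩ := hS.exists_chain
  have hg' : ∀ γ x, g.symm (Vgr.shift γ x) = Vgr.shift γ (g.symm x) := fun γ x => g.injective (by
    rw [hg, g.apply_symm_apply, g.apply_symm_apply])
  have hg1' : g.symm (Vgr.mk (GrProj.regular 𝓢)) = Vgr.mk (GrProj.regular 𝓡) := by
    rw [← hg1, g.symm_apply_apply]
  -- Compatibility with `g` is stored with each map, since it is what allows the next step.
  let α := Σ i, {φ : T i →ₐ[A] S // IsGradedMap (subalgebraGrading 𝓡 (T i)) 𝓢 φ ∧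
    IsCompatible g (subalgebraGrading 𝓡 (T i)) (T i).val φ}
  let β := Σ j, {ψ : T' j →ₐ[A] R // IsGradedMap (subalgebraGrading 𝓢 (T' j)) 𝓡 ψ ∧
    IsCompatible g.symm (subalgebraGrading 𝓢 (T' j)) (T' j).val ψ}
  have stepα : ∀ (N : ℕ) (a : α), ∃ b : β, N ≤ b.1 ∧
      ∀ x, ∃ h : a.2.1 x ∈ T' b.1, b.2.1 ⟨a.2.1 x, h⟩ = x := by
    rintro N ⟨i, φ, hφ, hφg⟩
    have := (hT i).finite
    obtain ⟨j, hj, hφj⟩ := exists_range_le_of_finite φ hTm' hTex' N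
    obtain ⟨ψ, hψ, hψg, h⟩ := exists_leftInverse_of_isCompatible hA hR.isGradedAlgebra g hg hg1
      (hT i) (hT' j) hφ hφg hφj
    exact ⟨⟨j, ψ, hψ, hψg⟩, hj, fun x => ⟨hφj x, h x⟩⟩
  have stepβ : ∀ (N : ℕ) (b : β), ∃ a : α, N ≤ a.1 ∧
      ∀ y, ∃ h : b.2.1 y ∈ T a.1, a.2.1 ⟨b.2.1 y, h⟩ = y := by
    rintro N ⟨j, ψ, hψ, hψg⟩
    have := (hT' j).finite
    obtain ⟨i, hi, hψi⟩ := exists_range_le_of_finite ψ hTm hTex N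
    obtain ⟨φ, hφ, hφg, h⟩ := exists_leftInverse_of_isCompatible hA hS.isGradedAlgebra g.symm hg'
      hg1' (hT' j) (hT i) hψ hψg hψi
    exact ⟨⟨i, φ, hφ, by simpa using hφg⟩, hi, fun y => ⟨hψi y, h y⟩⟩
  obtain ⟨φ₀, hφ₀, hφ₀g⟩ := (hT 0).exists_isCompatible hA hS.isGradedAlgebra g.toAddMonoidHom hg hg1
  choose F hFN hF using stepα
  choose G hGN hG using stepβ
  -- The lower bound passed at each step forces the `k`-th stage index to be at least `k`, so the
  -- selected stages exhaust both algebras.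
  let a : ℕ → α := fun k => Nat.rec ⟨0, φ₀, hφ₀, hφ₀g⟩ (fun k x => G (k + 1) (F k x)) k
  let b : ℕ → β := fun k => F k (a k)
  have ha : ∀ k, a (k + 1) = G (k + 1) (b k) := fun k => rfl
  have haN : ∀ k, k ≤ (a k).1 := fun k => by
    cases k with
    | zero => exact Nat.zero_le _
    | succ k => exact hGN _ _
  obtain ⟨e, he, he'⟩ := exists_algEquiv_of_intertwined (K := fun k => T (a k).1)
    (L := fun k => T' (b k).1) (fun k => (a k).2.1) (fun k => (b k).2.1) (fun k => hF k (a k))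
    (fun k => hG (k + 1) (b k))
    (fun x => by
      obtain ⟨k, hk⟩ := hTex x
      exact ⟨k, hTm (haN k) hk⟩)
    fun y => by
      obtain ⟨k, hk⟩ := hTex' y
      exact ⟨k, hTm' (hFN k (a k)) hk⟩
  refine ⟨e, fun γ x => ⟨fun hx => ?_, fun hx => ?_⟩⟩
  · obtain ⟨k, hk⟩ := hTex x
    rw [he k ⟨x, hTm (haN k) hk⟩]
    exact (a k).2.2.1 γ _ hx
  · obtain ⟨k, hk⟩ := hTex' (e x)
    rw [← e.symm_apply_apply x, he' k ⟨e x, hTm' (hFN k (a k)) hk⟩]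
    exact (b k).2.2.1 γ _ hx

end

theorem mainTheorem4 {Γ : Type uΓ} [AddCommGroup Γ] [DecidableEq Γ]
    {A : Type uA} [CommRing A] (𝒜 : Γ → AddSubgroup A) [GradedRing 𝒜] (hA : IsGradedField 𝒜)
    {R : Type uR} [Ring R] [Algebra A R] (𝓡 : Γ → AddSubgroup R) [GradedRing 𝓡]
    (hR : IsGradedUltramatricial 𝒜 𝓡)
    {S : Type uS} [Ring S] [Algebra A S] (𝓢 : Γ → AddSubgroup S) [GradedRing 𝓢]
    (hS : IsGradedUltramatricial 𝒜 𝓢) :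
    (∃ e : R ≃ₐ[A] S, IsGradedAlgEquiv 𝓡 𝓢 e) ↔
      ∃ f : K0gr 𝓡 ≃ₗ[AddMonoidAlgebra ℤ Γ] K0gr 𝓢,
        (∀ x, f x ∈ K0gr.positiveCone 𝓢 ↔ x ∈ K0gr.positiveCone 𝓡) ∧
          f (K0gr.unitClass 𝓡) = K0gr.unitClass 𝓢 := by
  constructor
  · rintro ⟨e, he⟩
    obtain ⟨g, hg, hg1⟩ := Vgr.exists_addEquiv_of_ringEquiv e.toRingEquiv he
    exact K0gr.exists_linearEquiv_of_addEquiv g hg hg1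
  · rintro ⟨f, hf, hf1⟩
    obtain ⟨g, hg, hg1⟩ := K0gr.exists_addEquiv_of_linearEquiv (hR.degreeZeroStableRangeOne hA)
      (hS.degreeZeroStableRangeOne hA) f hf hf1
    exact exists_gradedAlgEquiv_of_addEquiv hA hR hS g hg hg1
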